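/- **Setting.** Let $K,N,N_B\ge 0$ be integers and fix powers $p_k\ge0$, weights $\mu_k\ge0$, channels $\boldsymbol h_k,\boldsymbol g\in\mathbb C^N$, $\boldsymbol G_B\in\mathbb C^{N_B\times N}$, receive filters $\boldsymbol c_k\in\mathbb C^{N_B}$ $(1\le k\le K)$, noise variances $\sigma_B^2,\sigma_E^2,\sigma_{RIS}^2>0$, a bandwidth $B>0$, an amplifier power $P_{R,max}>0$ and a static power $P_c=NP_{c,n}+P_{0,RIS}+P_0>0$. Put $\boldsymbol H_k=\mathrm{diag}(\boldsymbol h_k)$, $\boldsymbol A_k=\boldsymbol G_B\boldsymbol H_k$, $\boldsymbol\Gamma=\mathrm{diag}(\boldsymbol\gamma)$, $\boldsymbol W=\sigma_B^2\boldsymbol I+\sigma_{RIS}^2\boldsymbol G_B\boldsymbol\Gamma\boldsymbol\Gamma^H\boldsymbol G_B^H$, $\boldsymbol R=\sum_k p_k\boldsymbol H_k^H\boldsymbol H_k+\sigma_{RIS}^2\boldsymbol I_N$, $P_{c,eq}=\sum_k\mu_kp_k+P_c-\mathrm{tr}(\boldsymbol R)$ and, for $\boldsymbol\gamma\in\mathbb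 C^N$, $$\mathrm{SINR}_{k,B}=\frac{p_k|\boldsymbol c_k^H\boldsymbol A_k\boldsymbol\gamma|^2}{\boldsymbol c_k^H\boldsymbol W\boldsymbol c_k+\sum_{m\ne k}p_m|\boldsymbol c_k^H\boldsymbol A_m\boldsymbol\gamma|^2},\qquad \mathrm{SINR}_{k,E}=\frac{p_k|\boldsymbol g^H\boldsymbol H_k\boldsymbol\gamma|^2}{\sigma_E^2+\sigma_{RIS}^2\boldsymbol g^H\boldsymbol\Gamma\boldsymbol\Gamma^H\boldsymbol g+\sum_{m\ne k}p_m|\boldsymbol g^H\boldsymbol H_m\boldsymbol\gamma|^2}$$ ($\mathrm{SINR}_{k,B}=0$ if $\boldsymbol c_k=\boldsymbol 0$). The $\boldsymbol\gamma$-problem is $$\max_{\boldsymbol\gamma}\ \mathrm{SEE}(\boldsymbol\gamma)=B\,\frac{\mathrm{SSR}(\boldsymbol\gamma)}{\mathrm{tr}(\boldsymbol R\boldsymbol\gamma\boldsymbol\gamma^H)+P_{c,eq}}\quad\text{s.t.}\quad \mathrm{tr}(\boldsymbol R)\le\mathrm{tr}(\boldsymbol R\boldsymbol\gamma\boldsymbol\gamma^H)\le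 P_{R,max}+\mathrm{tr}(\boldsymbol R),$$ with $\mathrm{SSR}=\sum_k[\log_2(1+\mathrm{SINR}_{k,B})-\log_2(1+\mathrm{SINR}_{k,E})]$. Its KKT conditions are understood with respect to the real and imaginary parts of $\boldsymbol\gamma$. **Surrogate.** Let $x_{B}=p_k|\boldsymbol c_k^H\boldsymbol A_k\boldsymbol\gamma|^2$ and $x_{E}=p_k|\boldsymbol g^H\boldsymbol H_k\boldsymbol\gamma|^2$ be the numerators of the two SINRs of user $k$, $y_B$ the denominator of $\mathrm{SINR}_{k,B}$, and $y_E$ the denominator of $\mathrm{SINR}_{k,E}$ minus $\sigma_E^2$; bars denote values at a given feasible $\bar{\boldsymbol\gamma}$; $\tilde x_B,\tilde y_E$ are the first-order Taylor expansions at $\bar{\boldsymbol\gamma}$ of $\sqrt{x_B},\sqrt{y_E}$. Define $$\begin{aligned}\widetilde R_k(\boldsymbol\gamma)=&\log_2\Bigl(1+\frac{\bar x_B}{\bar y_B}\Bigr)+\frac1{\ln2}\frac{\bar x_B}{\bar y_B}\Bigl(\frac{2\tilde x_B}{\sqrt{\bar x_B}}-\frac{x_B+y_B}{\bar x_B+\bar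 y_B}-1\Bigr)+\log_2\Bigl(1+\frac{\bar y_E}{\sigma_E^2}\Bigr)\\&+\frac1{\ln2}\frac{\bar y_E}{\sigma_E^2}\Bigl(\frac{2\tilde y_E}{\sqrt{\bar y_E}}-\frac{y_E+\sigma_E^2}{\bar y_E+\sigma_E^2}-1\Bigr)+\log_2\frac{\sigma_E^2}{\sigma_E^2+\bar x_E+\bar y_E}-\frac1{\ln 2}\frac{x_E+y_E-\bar x_E-\bar y_E}{\sigma_E^2+\bar x_E+\bar y_E},\end{aligned}$$ a term whose prefactor $\bar x_B/\bar y_B$ or $\bar y_E/\sigma_E^2$ is zero (or $\bar x_B/\bar y_B=0/0$, for $\boldsymbol c_k=\boldsymbol0$) being read as $0$. The subproblem at $\bar{\boldsymbol\gamma}$ is to maximise $\sum_k\widetilde R_k(\boldsymbol\gamma)/(\mathrm{tr}(\boldsymbol R\boldsymbol\gamma\boldsymbol\gamma^H)+P_{c,eq})$ subject to $\mathrm{tr}(\boldsymbol R\boldsymbol\gamma\boldsymbol\gamma^H)\le P_{R,max}+\mathrm{tr}(\boldsymbol R)$ and $\bar{\boldsymbol\gamma}^H\boldsymbol R\bar{\boldsymbol\gamma}+2\Re\{\bar{\boldsymbol\gamma}^H\boldsymbol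 R(\boldsymbol\gamma-\bar{\boldsymbol\gamma})\}\ge\mathrm{tr}(\boldsymbol R)$. **Algorithm.** Start from any feasible $\boldsymbol\gamma^{(0)}$; let $\boldsymbol\gamma^{(n+1)}$ be any global solution of the subproblem at $\boldsymbol\gamma^{(n)}$; stop when $|\mathrm{SEE}(\boldsymbol\gamma^{(n+1)})-\mathrm{SEE}(\boldsymbol\gamma^{(n)})|<\epsilon$. **Claim.** The $\boldsymbol\gamma$-problem is feasible. For every feasible $\bar{\boldsymbol\gamma}$, the subproblem is a fractional program with concave numerator, convex denominator that is positive on the feasible set of the subproblem, and convex feasible set; that set contains $\bar{\boldsymbol\gamma}$ and is contained in the feasible set of the $\boldsymbol\gamma$-problem; the numerator is a lower bound of $\mathrm{SSR}$ on $\mathbb C^N$, with equality at $\bar{\boldsymbol\gamma}$; and the subproblem has a solution. For every sequence of iterates (with the stopping rule not applied): 1. all iterates are feasible and $\mathrm{SEE}(\boldsymbol\gamma^{(n)})\le\mathrm{SEE}(\boldsymbol\gamma^{(n+1)})$, with strict inequality if $\boldsymbol\gamma^{(n)}$ does not satisfy the KKT conditions of the $\boldsymbol\gamma$-problem; 2.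 for every $\epsilon>0$ the stopping rule is met after finitely many steps; 3. the iterates converge to KKT points of the $\boldsymbol\gamma$-problem in the usual sense of sequential programming: the sequence has accumulation points, each of them satisfies the KKT conditions, $\mathrm{SEE}(\boldsymbol\gamma^{(n)})$ converges to the value of $\mathrm{SEE}$ at any of them, and the distance from $\boldsymbol\gamma^{(n)}$ to the set of KKT points tends to $0$; 4. if $\mathrm{SSR}(\boldsymbol\gamma^{(n)})>0$ for some $n$, then $\|\boldsymbol\gamma^{(n+1)}-\boldsymbol\gamma^{(n)}\|\to0$. -/

import Mathlib

open Filter Topology Matrix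

noncomputable section

/-- Data of the RIS-aided uplink with an eavesdropper, with powers and receive filters fixed:
`K` single-antenna users, an active RIS with `N` elements, a receiver with `NB` antennas.
`varB`, `varE`, `varRIS` are the noise variances `σ_B²`, `σ_E²`, `σ_RIS²`. -/
structure RISSystem (K N NB : ℕ) where
  /-- transmit powers -/
  p : Fin K → ℝ
  /-- weights of the transmit powers in the consumed power -/
  μ : Fin K → ℝ
  /-- user-RIS channels -/
  h : Fin K → EuclideanSpace ℂ (Fin N)
  /-- RIS-receiver channel -/
  GB : Matrix (Fin NB) (Fin N) ℂ
  /-- RIS-eavesdropper channel -/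
  g : EuclideanSpace ℂ (Fin N)
  /-- linear receive filters -/
  c : Fin K → EuclideanSpace ℂ (Fin NB)
  varB : ℝ
  varE : ℝ
  varRIS : ℝ
  /-- bandwidth -/
  B : ℝ
  /-- maximum radio-frequency power of the RIS amplifier -/
  PRmax : ℝ
  /-- static power of one RIS element -/
  Pcn : ℝ
  /-- rest of the static power of the RIS -/
  P0RIS : ℝ
  /-- static power of transmitters and legitimate receiver -/
  P0 : ℝ

/-- KKT conditions at `x` for the problem `max F` subject to `G i ≤ 0` for all `i`, on a real
normed space: differentiability, primal feasibility, and multipliers `l i ≥ 0` with stationarity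
and complementary slackness. On `ℂ^N` the derivatives are real ones, i.e. with respect to the
real and imaginary parts of the entries. -/
def IsKKTPoint {E ι : Type*} [NormedAddCommGroup E] [NormedSpace ℝ E] [Fintype ι]
    (F : E → ℝ) (G : ι → E → ℝ) (x : E) : Prop :=
  DifferentiableAt ℝ F x ∧ (∀ i, DifferentiableAt ℝ (G i) x) ∧ (∀ i, G i x ≤ 0) ∧
    ∃ l : ι → ℝ, (∀ i, 0 ≤ l i) ∧ (∀ i, l i * G i x = 0) ∧
      fderiv ℝ F x = ∑ i, l i • fderiv ℝ (G i) x

namespace RISSystem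

variable {K N NB : ℕ} (S : RISSystem K N NB)

/-! ### The original problem -/

/-- `H_k = diag(h_k)` -/
def H (k : Fin K) : Matrix (Fin N) (Fin N) ℂ := Matrix.diagonal (S.h k).ofLp

/-- `A_k = G_B H_k` -/
def A (k : Fin K) : Matrix (Fin NB) (Fin N) ℂ := S.GB * S.H k

/-- `Γ = diag(γ)` -/
def Gam (γ : EuclideanSpace ℂ (Fin N)) : Matrix (Fin N) (Fin N) ℂ := Matrix.diagonal γ.ofLp

/-- Noise covariance at the receiver, `W = σ_B² I + σ_RIS² G_B Γ Γᴴ G_Bᴴ`. -/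
def W (γ : EuclideanSpace ℂ (Fin N)) : Matrix (Fin NB) (Fin NB) ℂ :=
  (S.varB : ℂ) • (1 : Matrix (Fin NB) (Fin NB) ℂ) +
    (S.varRIS : ℂ) • (S.GB * Gam γ * (Gam γ)ᴴ * S.GBᴴ)

/-- `c_kᴴ A_m γ` -/
def ampB (k m : Fin K) (γ : EuclideanSpace ℂ (Fin N)) : ℂ :=
  star (S.c k).ofLp ⬝ᵥ (S.A m *ᵥ γ.ofLp)

/-- `gᴴ H_m γ` -/
def ampE (m : Fin K) (γ : EuclideanSpace ℂ (Fin N)) : ℂ :=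
  star S.g.ofLp ⬝ᵥ (S.H m *ᵥ γ.ofLp)

/-- SINR of user `k` at the legitimate receiver (for a zero filter `c_k` this is `0/0 = 0`,
the value for a user that is not decoded). -/
def sinrB (k : Fin K) (γ : EuclideanSpace ℂ (Fin N)) : ℝ :=
  S.p k * ‖S.ampB k k γ‖ ^ 2 /
    ((star (S.c k).ofLp ⬝ᵥ (S.W γ *ᵥ (S.c k).ofLp)).re +
      ∑ m ∈ Finset.univ.erase k, S.p m * ‖S.ampB k m γ‖ ^ 2)

/-- SINR of user `k` at the eavesdropper. -/
def sinrE (k : Fin K) (γ : EuclideanSpace ℂ (Fin N)) : ℝ :=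
  S.p k * ‖S.ampE k γ‖ ^ 2 /
    (S.varE + S.varRIS * (star S.g.ofLp ⬝ᵥ ((Gam γ * (Gam γ)ᴴ) *ᵥ S.g.ofLp)).re +
      ∑ m ∈ Finset.univ.erase k, S.p m * ‖S.ampE m γ‖ ^ 2)

/-- System secrecy sum-rate. -/
def ssr (γ : EuclideanSpace ℂ (Fin N)) : ℝ :=
  ∑ k, (Real.logb 2 (1 + S.sinrB k γ) - Real.logb 2 (1 + S.sinrE k γ))

/-- `R = ∑ₖ p_k H_kᴴ H_k + σ_RIS² I` -/
def R : Matrix (Fin N) (Fin N) ℂ :=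
  ∑ k, (S.p k : ℂ) • ((S.H k)ᴴ * S.H k) + (S.varRIS : ℂ) • (1 : Matrix (Fin N) (Fin N) ℂ)

/-- `tr(R)` -/
def trR : ℝ := S.R.trace.re

/-- `tr(R γ γᴴ)` -/
def outPower (γ : EuclideanSpace ℂ (Fin N)) : ℝ :=
  (S.R * Matrix.vecMulVec γ.ofLp (star γ.ofLp)).trace.re

/-- Static power `P_c = N P_{c,n} + P_{0,RIS} + P_0`. -/
def Pc : ℝ := N * S.Pcn + S.P0RIS + S.P0

/-- `P_{c,eq} = ∑ₖ μ_k p_k + P_c - tr(R)` -/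
def Pceq : ℝ := ∑ k, S.μ k * S.p k + S.Pc - S.trR

/-- Total consumed power `tr(R γ γᴴ) + P_{c,eq}`. -/
def totalPower (γ : EuclideanSpace ℂ (Fin N)) : ℝ := S.outPower γ + S.Pceq

/-- Secrecy energy efficiency, the objective of the `γ`-problem. -/
def see (γ : EuclideanSpace ℂ (Fin N)) : ℝ := S.B * (S.ssr γ / S.totalPower γ)

/-- The two constraints of the `γ`-problem, in the form `≤ 0`:
`tr(R) ≤ tr(R γ γᴴ)` and `tr(R γ γᴴ) ≤ P_{R,max} + tr(R)`. -/
def constr : Fin 2 → EuclideanSpace ℂ (Fin N) → ℝ :=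
  ![fun γ => S.trR - S.outPower γ, fun γ => S.outPower γ - (S.PRmax + S.trR)]

/-- Feasible set of the `γ`-problem. -/
def feasible : Set (EuclideanSpace ℂ (Fin N)) := {γ | ∀ i, S.constr i γ ≤ 0}

/-- Points satisfying the KKT conditions of the `γ`-problem. -/
def kktSet : Set (EuclideanSpace ℂ (Fin N)) := {γ | IsKKTPoint S.see S.constr γ}

/-! ### The surrogate problem at `γb` -/

/-- `γᴴ M γ`, for Hermitian `M` -/
def quad (M : Matrix (Fin N) (Fin N) ℂ) (γ : EuclideanSpace ℂ (Fin N)) : ℝ :=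
  (star γ.ofLp ⬝ᵥ (M *ᵥ γ.ofLp)).re

/-- `Re(γbᴴ M (γ - γb))` -/
def lin (M : Matrix (Fin N) (Fin N) ℂ) (γb γ : EuclideanSpace ℂ (Fin N)) : ℝ :=
  (star γb.ofLp ⬝ᵥ (M *ᵥ (γ - γb).ofLp)).re

/-- `Ũ_k = diag(|u_1|², …, |u_N|²)` with `u = G_Bᴴ c_k` -/
def U (k : Fin K) : Matrix (Fin N) (Fin N) ℂ :=
  Matrix.diagonal fun n => ((‖(S.GBᴴ *ᵥ (S.c k).ofLp) n‖ ^ 2 : ℝ) : ℂ)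

/-- `G = diag(g)` -/
def G : Matrix (Fin N) (Fin N) ℂ := Matrix.diagonal S.g.ofLp

/-- `x_B` -/
def xB (k : Fin K) (γ : EuclideanSpace ℂ (Fin N)) : ℝ := S.p k * ‖S.ampB k k γ‖ ^ 2

/-- `x_E` -/
def xE (k : Fin K) (γ : EuclideanSpace ℂ (Fin N)) : ℝ := S.p k * ‖S.ampE k γ‖ ^ 2

/-- `y_B` -/
def yB (k : Fin K) (γ : EuclideanSpace ℂ (Fin N)) : ℝ :=
  S.varB * ‖S.c k‖ ^ 2 + S.varRIS * quad (S.U k) γ +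
    ∑ m ∈ Finset.univ.erase k, S.p m * ‖S.ampB k m γ‖ ^ 2

/-- `y_E` -/
def yE (k : Fin K) (γ : EuclideanSpace ℂ (Fin N)) : ℝ :=
  ∑ m ∈ Finset.univ.erase k, S.p m * ‖S.ampE m γ‖ ^ 2 +
    S.varRIS * ‖WithLp.toLp 2 (S.G *ᵥ γ.ofLp)‖ ^ 2

/-- `M_{k,B} = A_kᴴ c_k c_kᴴ A_k` -/
def MB (k : Fin K) : Matrix (Fin N) (Fin N) ℂ :=
  (S.A k)ᴴ * Matrix.vecMulVec (S.c k).ofLp (star (S.c k).ofLp) * S.A k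

/-- `M_{k,E} = ∑_{m ≠ k} p_m H_mᴴ g gᴴ H_m + σ_RIS² G Gᴴ` -/
def ME (k : Fin K) : Matrix (Fin N) (Fin N) ℂ :=
  ∑ m ∈ Finset.univ.erase k,
      (S.p m : ℂ) • ((S.H m)ᴴ * Matrix.vecMulVec S.g.ofLp (star S.g.ofLp) * S.H m) +
    (S.varRIS : ℂ) • (S.G * S.Gᴴ)

/-- First-order Taylor expansion at `γb` of `√x_B = √p_k · √(γᴴ M_{k,B} γ)`. -/
def xTilde (k : Fin K) (γb γ : EuclideanSpace ℂ (Fin N)) : ℝ :=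
  √(S.p k) * (√(quad (S.MB k) γb) + lin (S.MB k) γb γ / √(quad (S.MB k) γb))

/-- First-order Taylor expansion at `γb` of `√y_E = √(γᴴ M_{k,E} γ)`. -/
def yTilde (k : Fin K) (γb γ : EuclideanSpace ℂ (Fin N)) : ℝ :=
  √(quad (S.ME k) γb) + lin (S.ME k) γb γ / √(quad (S.ME k) γb)

/-- Concave surrogate of the secrecy rate of user `k`. If `x_B` (or `y_E`) vanishes at `γb`,
the prefactor `xB k γb / yB k γb` (or `yE k γb / varE`) is `0` and the whole term is `0`, which
is also its limit. -/
def rateTilde (k : Fin K) (γb γ : EuclideanSpace ℂ (Fin N)) : ℝ :=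
  Real.logb 2 (1 + S.xB k γb / S.yB k γb) +
    1 / Real.log 2 * (S.xB k γb / S.yB k γb *
      (2 * S.xTilde k γb γ / √(S.xB k γb) -
        (S.xB k γ + S.yB k γ) / (S.xB k γb + S.yB k γb) - 1)) +
  Real.logb 2 (1 + S.yE k γb / S.varE) +
    1 / Real.log 2 * (S.yE k γb / S.varE *
      (2 * S.yTilde k γb γ / √(S.yE k γb) -
        (S.yE k γ + S.varE) / (S.yE k γb + S.varE) - 1)) +
  Real.logb 2 (S.varE / (S.varE + S.xE k γb + S.yE k γb)) -
    1 / Real.log 2 * ((S.xE k γ + S.yE k γ - S.xE k γb - S.yE k γb) /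
      (S.varE + S.xE k γb + S.yE k γb))

/-- Numerator of the surrogate objective. -/
def ssrTilde (γb γ : EuclideanSpace ℂ (Fin N)) : ℝ := ∑ k, S.rateTilde k γb γ

/-- Feasible set of the surrogate problem: the upper power constraint and the linearised lower
power constraint. -/
def feasibleTilde (γb : EuclideanSpace ℂ (Fin N)) : Set (EuclideanSpace ℂ (Fin N)) :=
  {γ | S.outPower γ ≤ S.PRmax + S.trR ∧ S.trR ≤ quad S.R γb + 2 * lin S.R γb γ}

/-- `γs` is a (global) solution of the surrogate fractional program at `γb`. -/
def IsSubproblemSolution (γb γs : EuclideanSpace ℂ (Fin N)) : Prop :=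
  γs ∈ S.feasibleTilde γb ∧
    IsMaxOn (fun γ => S.ssrTilde γb γ / S.totalPower γ) (S.feasibleTilde γb) γs

/-- Iterates of the algorithm (stopping rule not applied): an arbitrary feasible start, and each
iterate is a solution, arbitrarily chosen, of the surrogate problem at the previous one. -/
def IsAlgorithmRun (γ : ℕ → EuclideanSpace ℂ (Fin N)) : Prop :=
  γ 0 ∈ S.feasible ∧ ∀ n, S.IsSubproblemSolution (γ n) (γ (n + 1))

end RISSystem

end

noncomputable section

namespace RISSystem

open scoped ComplexOrder

variable {N : ℕ}

/-! ### Real quadratic forms of complex matrices -/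

/-! All signal and noise powers are constants plus positive semidefinite quadratic forms in `γ`. The
secrecy rate of a user splits into `log (1 + xB / yB)`, `log (1 + yE / varE)` and `log (varE / (varE
+ xE + yE))`. The first two have a tight quadratic minorant (`le_log_one_add_div`), which comes from
`log t ≤ t - 1` and nonnegativity of the form at `γ - t • γb`; the third is bounded by a tangent
line (`le_log_div_add`). With the square roots cancelled (`rateTilde_eq`), the surrogate is affine
minus a positive semidefinite form, hence concave, and it is continuous in the base point too.
Linearising the convex lower power constraint shrinks the feasible set, so `see (γ n) ≤ B * seeTilde
(γ n) (γ (n+1)) ≤ see (γ (n+1))`. Compactness makes the values converge.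

The KKT criterion is `mem_kktSet_of_forall_le`: it suffices that no strictly feasible point of the
surrogate problem at `γ` beats `γ`. The surrogate touches the objective from below, so their
gradients agree. At most one power constraint is active, and moving along `γ` or `-γ` relaxes it.
Strict feasibility is an open condition in the base point, so an improving point at a cluster point
would also improve at infinitely many iterates and push the objective above its limit
(`mem_kktSet_of_mapClusterPt`).

Consecutive iterates merge because the consumed power is strongly convex: for a nonnegative
surrogate value, comparison with a midpoint bounds the squared step by the gain (`sq_dist_le`). -/

/-- The real bilinear form `Re(aᴴ M b)`. -/
def blin (M : Matrix (Fin N) (Fin N) ℂ) (a b : EuclideanSpace ℂ (Fin N)) : ℝ :=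
  (star a.ofLp ⬝ᵥ (M *ᵥ b.ofLp)).re

theorem blin_self (M : Matrix (Fin N) (Fin N) ℂ) (a : EuclideanSpace ℂ (Fin N)) :
    blin M a a = quad M a := rfl

theorem blin_add_right (M : Matrix (Fin N) (Fin N) ℂ) (a b c : EuclideanSpace ℂ (Fin N)) :
    blin M a (b + c) = blin M a b + blin M a c := by
  simp [blin, mulVec_add, dotProduct_add]

theorem blin_add_left (M : Matrix (Fin N) (Fin N) ℂ) (a b c : EuclideanSpace ℂ (Fin N)) :
    blin M (a + b) c = blin M a c + blin M b c := by
  simp [blin, star_add, add_dotProduct]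

theorem blin_smul_right (M : Matrix (Fin N) (Fin N) ℂ) (t : ℝ) (a b : EuclideanSpace ℂ (Fin N)) :
    blin M a (t • b) = t * blin M a b := by
  simp [blin, mulVec_smul, dotProduct_smul]

theorem blin_smul_left (M : Matrix (Fin N) (Fin N) ℂ) (t : ℝ) (a b : EuclideanSpace ℂ (Fin N)) :
    blin M (t • a) b = t * blin M a b := by
  simp [blin, star_smul, smul_dotProduct]

theorem blin_comm {M : Matrix (Fin N) (Fin N) ℂ} (hM : M.IsHermitian)
    (a b : EuclideanSpace ℂ (Fin N)) : blin M a b = blin M b a := by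
  have h : star (star a.ofLp ⬝ᵥ (M *ᵥ b.ofLp)) = star b.ofLp ⬝ᵥ (M *ᵥ a.ofLp) := by
    rw [← star_dotProduct_star, star_star, star_mulVec, hM.eq,
      dotProduct_mulVec, dotProduct_comm]
  simp only [blin, ← h]
  simp

theorem blin_sub_right (M : Matrix (Fin N) (Fin N) ℂ) (a b c : EuclideanSpace ℂ (Fin N)) :
    blin M a (b - c) = blin M a b - blin M a c := by
  simp [blin, mulVec_sub, dotProduct_sub]

theorem lin_eq (M : Matrix (Fin N) (Fin N) ℂ) (a b : EuclideanSpace ℂ (Fin N)) :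
    lin M a b = blin M a b - quad M a := by
  rw [← blin_self, ← blin_sub_right]; rfl

theorem quad_add_smul {M : Matrix (Fin N) (Fin N) ℂ} (hM : M.IsHermitian) (t : ℝ)
    (a b : EuclideanSpace ℂ (Fin N)) :
    quad M (a + t • b) = quad M a + 2 * t * blin M a b + t ^ 2 * quad M b := by
  simp only [← blin_self, blin_add_left, blin_add_right, blin_smul_left, blin_smul_right,
    blin_comm hM b a]
  ring

/-- The exact convexity defect of a quadratic form. It yields concavity of the surrogate and, for
`R`, the strong convexity behind `sq_dist_le`. No symmetry is needed, since both cross terms occur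
together. -/
theorem quad_combo (M : Matrix (Fin N) (Fin N) ℂ) {s t : ℝ} (hst : s + t = 1)
    (a b : EuclideanSpace ℂ (Fin N)) :
    quad M (s • a + t • b) = s * quad M a + t * quad M b - s * t * quad M (a - b) := by
  have h : a - b = a + (-1 : ℝ) • b := by simp [sub_eq_add_neg]
  obtain rfl : t = 1 - s := by linarith
  rw [h]
  simp only [← blin_self, blin_add_left, blin_add_right, blin_smul_left, blin_smul_right]
  ring

theorem quad_nonneg {M : Matrix (Fin N) (Fin N) ℂ} (hM : M.PosSemidef)
    (a : EuclideanSpace ℂ (Fin N)) : 0 ≤ quad M a :=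
  hM.re_dotProduct_nonneg a.ofLp

theorem quad_sub_smul_nonneg {M : Matrix (Fin N) (Fin N) ℂ} (hM : M.PosSemidef) (t : ℝ)
    (a b : EuclideanSpace ℂ (Fin N)) :
    0 ≤ quad M b - 2 * t * blin M a b + t ^ 2 * quad M a := by
  have h := quad_nonneg hM (b + (-t) • a)
  rw [quad_add_smul hM.1, blin_comm hM.1] at h
  linarith

/-- Degenerate Cauchy–Schwarz. It makes the linear part vanish wherever a square root in the
surrogate has a singular Taylor expansion. -/
theorem blin_eq_zero {M : Matrix (Fin N) (Fin N) ℂ} (hM : M.PosSemidef)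
    {a : EuclideanSpace ℂ (Fin N)} (ha : quad M a = 0) (b : EuclideanSpace ℂ (Fin N)) :
    blin M a b = 0 := by
  by_contra h
  -- With no quadratic term left, this multiplier drives the form to `-1`.
  have := quad_sub_smul_nonneg hM ((quad M b + 1) / (2 * blin M a b)) a b
  have e : 2 * ((quad M b + 1) / (2 * blin M a b)) * blin M a b = quad M b + 1 := by
    field_simp
  rw [ha, e] at this
  linarith

theorem convexOn_quad {M : Matrix (Fin N) (Fin N) ℂ} (hM : M.PosSemidef) :
    ConvexOn ℝ Set.univ (quad M) := by
  refine ⟨convex_univ, fun a _ b _ s t hs ht hst => ?_⟩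
  have := mul_nonneg (mul_nonneg hs ht) (quad_nonneg hM (a - b))
  rw [quad_combo M hst, smul_eq_mul, smul_eq_mul]
  linarith

theorem blin_eq_inner (M : Matrix (Fin N) (Fin N) ℂ) (a b : EuclideanSpace ℂ (Fin N)) :
    blin M a b = (inner ℂ a (Matrix.toEuclideanCLM (𝕜 := ℂ) M b)).re := by
  rw [EuclideanSpace.inner_eq_star_dotProduct, Matrix.ofLp_toEuclideanCLM, dotProduct_comm]
  rfl

theorem differentiable_blin {F : Type*} [NormedAddCommGroup F] [NormedSpace ℝ F]
    (M : Matrix (Fin N) (Fin N) ℂ) {f g : F → EuclideanSpace ℂ (Fin N)}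
    (hf : Differentiable ℝ f) (hg : Differentiable ℝ g) :
    Differentiable ℝ fun x => blin M (f x) (g x) := by
  simp only [blin_eq_inner]
  exact Complex.reCLM.differentiable.comp (Differentiable.inner ℂ hf
    (((Matrix.toEuclideanCLM (𝕜 := ℂ) M).restrictScalars ℝ).differentiable.comp hg))

theorem differentiable_quad (M : Matrix (Fin N) (Fin N) ℂ) : Differentiable ℝ (quad M) :=
  differentiable_blin M differentiable_id differentiable_id

theorem continuous_quad (M : Matrix (Fin N) (Fin N) ℂ) : Continuous (quad M) :=
  (differentiable_quad M).continuous

theorem continuous_blin_left (M : Matrix (Fin N) (Fin N) ℂ) (b : EuclideanSpace ℂ (Fin N)) :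
    Continuous fun a => blin M a b :=
  (differentiable_blin M differentiable_id (differentiable_const b)).continuous

theorem differentiable_blin_right (M : Matrix (Fin N) (Fin N) ℂ)
    (a : EuclideanSpace ℂ (Fin N)) : Differentiable ℝ (blin M a) :=
  differentiable_blin M (differentiable_const a) differentiable_id

/-- Both sides are the derivative at `0` of `t ↦ quad M (a + t • d)`, once by the chain rule and
once from the explicit expansion. -/
theorem fderiv_quad {M : Matrix (Fin N) (Fin N) ℂ} (hM : M.IsHermitian)
    (a d : EuclideanSpace ℂ (Fin N)) : fderiv ℝ (quad M) a d = 2 * blin M a d := by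
  have h1 : HasDerivAt (fun t : ℝ => quad M (a + t • d)) (fderiv ℝ (quad M) a d) 0 := by
    have hl : HasDerivAt (fun t : ℝ => a + t • d) d 0 := by
      simpa using ((hasDerivAt_id (0 : ℝ)).smul_const d).const_add a
    have hq : HasFDerivAt (quad M) (fderiv ℝ (quad M) a) (a + (0 : ℝ) • d) := by
      simpa using (differentiable_quad M a).hasFDerivAt
    exact hq.comp_hasDerivAt _ hl
  have h2 : HasDerivAt (fun t : ℝ => quad M (a + t • d)) (2 * blin M a d) 0 := by
    simp only [quad_add_smul hM]
    have := (((hasDerivAt_id (0 : ℝ)).const_mul (2 * blin M a d)).const_add (quad M a)).add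
      (((hasDerivAt_id (0 : ℝ)).pow 2).mul_const (quad M d))
    refine (this.congr_deriv (by simp)).congr_of_eventuallyEq (Eventually.of_forall fun t => ?_)
    simp
    ring
  exact h1.unique h2

theorem quad_add_matrix (M M' : Matrix (Fin N) (Fin N) ℂ) (a : EuclideanSpace ℂ (Fin N)) :
    quad (M + M') a = quad M a + quad M' a := by
  simp [quad, add_mulVec, dotProduct_add]

theorem quad_smul_matrix (r : ℝ) (M : Matrix (Fin N) (Fin N) ℂ) (a : EuclideanSpace ℂ (Fin N)) :
    quad ((r : ℂ) • M) a = r * quad M a := by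
  simp [quad, smul_mulVec, dotProduct_smul]

theorem blin_smul_matrix (r : ℝ) (M : Matrix (Fin N) (Fin N) ℂ)
    (a b : EuclideanSpace ℂ (Fin N)) : blin ((r : ℂ) • M) a b = r * blin M a b := by
  simp [blin, smul_mulVec, dotProduct_smul]

theorem quad_sum_matrix {ι : Type*} (s : Finset ι) (M : ι → Matrix (Fin N) (Fin N) ℂ)
    (a : EuclideanSpace ℂ (Fin N)) : quad (∑ i ∈ s, M i) a = ∑ i ∈ s, quad (M i) a := by
  classical
  induction s using Finset.induction_on with
  | empty => simp [quad]
  | insert i s hi ih => rw [Finset.sum_insert hi, Finset.sum_insert hi, quad_add_matrix, ih]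

theorem quad_conj {n : ℕ} (B : Matrix (Fin n) (Fin N) ℂ) (c : EuclideanSpace ℂ (Fin n))
    (a : EuclideanSpace ℂ (Fin N)) :
    quad (Bᴴ * vecMulVec c.ofLp (star c.ofLp) * B) a =
      ‖star c.ofLp ⬝ᵥ (B *ᵥ a.ofLp)‖ ^ 2 := by
  set z := star c.ofLp ⬝ᵥ (B *ᵥ a.ofLp) with hz
  have h1 : star (B *ᵥ a.ofLp) ⬝ᵥ c.ofLp = star z := by
    rw [hz, ← star_dotProduct_star, star_star, dotProduct_comm]
  have h2 : star a.ofLp ⬝ᵥ ((Bᴴ * vecMulVec c.ofLp (star c.ofLp) * B) *ᵥ a.ofLp) =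
      star z * z := by
    rw [← mulVec_mulVec, ← mulVec_mulVec, vecMulVec_mulVec, dotProduct_mulVec, ← star_mulVec,
      ← hz, dotProduct_smul, h1]
    simp
  rw [quad, h2, ← Complex.normSq_eq_norm_sq]
  simp [Complex.normSq_apply]

theorem quad_diagonal (w : Fin N → ℝ) (a : EuclideanSpace ℂ (Fin N)) :
    quad (diagonal fun n => (w n : ℂ)) a = ∑ n, w n * ‖a n‖ ^ 2 := by
  simp only [quad, dotProduct, mulVec_diagonal, Complex.re_sum, Pi.star_apply]
  refine Finset.sum_congr rfl fun n _ => ?_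
  rw [← Complex.normSq_eq_norm_sq]
  simp [Complex.normSq_apply]
  ring

theorem posSemidef_conj {n : ℕ} (B : Matrix (Fin n) (Fin N) ℂ) (c : EuclideanSpace ℂ (Fin n)) :
    (Bᴴ * vecMulVec c.ofLp (star c.ofLp) * B).PosSemidef :=
  (posSemidef_vecMulVec_self_star c.ofLp).conjTranspose_mul_mul_same B

theorem posSemidef_ofReal_smul {M : Matrix (Fin N) (Fin N) ℂ} (hM : M.PosSemidef) {r : ℝ}
    (hr : 0 ≤ r) : ((r : ℂ) • M).PosSemidef :=
  hM.smul (by exact_mod_cast hr)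

theorem posSemidef_diagonal_ofReal {w : Fin N → ℝ} (hw : ∀ n, 0 ≤ w n) :
    (diagonal fun n => (w n : ℂ)).PosSemidef :=
  PosSemidef.diagonal fun n => by
    show (0 : ℂ) ≤ (w n : ℂ)
    exact_mod_cast hw n

/-! ### The quadratic lower bound for the rate function -/

/-- Minorant of `log (1 + x / y)` where `x = Q(γ)` for a positive semidefinite form `Q`,
`x₀ = Q(γ₀)`, and `b` is the polarisation at `(γ₀, γ)`. -/
theorem le_log_one_add_div {x y x₀ y₀ b : ℝ} (hx : 0 ≤ x) (hy : 0 < y) (hx₀ : 0 ≤ x₀)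
    (hy₀ : 0 < y₀) (hb : ∀ t : ℝ, 0 ≤ x - 2 * t * b + t ^ 2 * x₀) :
    Real.log (1 + x₀ / y₀) +
      (2 * b / y₀ - x₀ / y₀ * ((x + y) / (x₀ + y₀)) - x₀ / y₀) ≤ Real.log (1 + x / y) := by
  have hxy : 0 < x + y := by linarith
  have hxy₀ : 0 < x₀ + y₀ := by linarith
  have e₀ : 1 + x₀ / y₀ = (x₀ + y₀) / y₀ := by field_simp; ring
  have e : 1 + x / y = (x + y) / y := by field_simp; ring
  have h1 := Real.log_le_sub_one_of_pos
    (show 0 < (x₀ + y₀) / y₀ / ((x + y) / y) by positivity)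
  rw [Real.log_div (by positivity) (by positivity)] at h1
  -- For this multiplier the gap left by `log t ≤ t - 1` is exactly a positive multiple of the form.
  have h2 := hb ((x + y) / (x₀ + y₀))
  have h3 : 1 - (x₀ + y₀) / y₀ / ((x + y) / y) -
      (2 * b / y₀ - x₀ / y₀ * ((x + y) / (x₀ + y₀)) - x₀ / y₀) =
      (x₀ + y₀) / (y₀ * (x + y)) *
        (x - 2 * ((x + y) / (x₀ + y₀)) * b + ((x + y) / (x₀ + y₀)) ^ 2 * x₀) := by
    field_simp
    ring
  have h4 : 0 ≤ (x₀ + y₀) / (y₀ * (x + y)) *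
      (x - 2 * ((x + y) / (x₀ + y₀)) * b + ((x + y) / (x₀ + y₀)) ^ 2 * x₀) :=
    mul_nonneg (by positivity) h2
  rw [e₀, e]
  linarith

/-- Minorant of `log (s / (s + z))`. -/
theorem le_log_div_add {s z z₀ : ℝ} (hs : 0 < s) (hz : 0 ≤ z) (hz₀ : 0 ≤ z₀) :
    Real.log (s / (s + z₀)) - (z - z₀) / (s + z₀) ≤ Real.log (s / (s + z)) := by
  have h1 := Real.log_le_sub_one_of_pos (show 0 < (s + z) / (s + z₀) by positivity)
  rw [Real.log_div (by positivity) (by positivity)] at h1 ⊢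
  rw [Real.log_div (by positivity) (by positivity)]
  have : (s + z) / (s + z₀) - 1 = (z - z₀) / (s + z₀) := by field_simp; ring
  linarith

variable {K NB : ℕ} (S : RISSystem K N NB)

/-! ### The powers of the system as quadratic forms -/

/-- The form `|c_kᴴ A_m γ|²`. -/
def VB (k m : Fin K) : Matrix (Fin N) (Fin N) ℂ :=
  (S.A m)ᴴ * vecMulVec (S.c k).ofLp (star (S.c k).ofLp) * S.A m

/-- The form `x_B`. -/
def XB (k : Fin K) : Matrix (Fin N) (Fin N) ℂ := (S.p k : ℂ) • S.MB k

/-- The form `y_B - σ_B² ‖c_k‖²`. -/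
def YB (k : Fin K) : Matrix (Fin N) (Fin N) ℂ :=
  (S.varRIS : ℂ) • S.U k + ∑ m ∈ Finset.univ.erase k, (S.p m : ℂ) • S.VB k m

/-- The form `x_E`. -/
def XE (k : Fin K) : Matrix (Fin N) (Fin N) ℂ :=
  (S.p k : ℂ) • ((S.H k)ᴴ * vecMulVec S.g.ofLp (star S.g.ofLp) * S.H k)

/-- The diagonal entries of `R`. -/
def rdiag (n : Fin N) : ℝ := ∑ k, S.p k * ‖S.h k n‖ ^ 2 + S.varRIS

theorem quad_VB (k m : Fin K) (γ : EuclideanSpace ℂ (Fin N)) :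
    quad (S.VB k m) γ = ‖S.ampB k m γ‖ ^ 2 := quad_conj _ _ _

theorem xB_eq_quad (k : Fin K) (γ : EuclideanSpace ℂ (Fin N)) :
    S.xB k γ = quad (S.XB k) γ := by
  rw [XB, quad_smul_matrix, MB, quad_conj]; rfl

theorem yB_eq_quad (k : Fin K) (γ : EuclideanSpace ℂ (Fin N)) :
    S.yB k γ = S.varB * ‖S.c k‖ ^ 2 + quad (S.YB k) γ := by
  simp only [YB, quad_add_matrix, quad_smul_matrix, quad_sum_matrix, quad_VB, yB, add_assoc]

theorem xE_eq_quad (k : Fin K) (γ : EuclideanSpace ℂ (Fin N)) :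
    S.xE k γ = quad (S.XE k) γ := by
  rw [XE, quad_smul_matrix, quad_conj]; rfl

theorem quad_diagonal_mul_conj (g γ : EuclideanSpace ℂ (Fin N)) :
    quad (diagonal g.ofLp * (diagonal g.ofLp)ᴴ) γ = ∑ n, ‖g n‖ ^ 2 * ‖γ n‖ ^ 2 := by
  rw [← quad_diagonal, diagonal_conjTranspose, diagonal_mul_diagonal]
  congr 2
  funext n
  simp [Complex.mul_conj, Complex.normSq_eq_norm_sq]

theorem yE_eq_quad (k : Fin K) (γ : EuclideanSpace ℂ (Fin N)) :
    S.yE k γ = quad (S.ME k) γ := by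
  rw [ME, quad_add_matrix, quad_smul_matrix, quad_sum_matrix, G, quad_diagonal_mul_conj, yE]
  simp only [quad_smul_matrix, quad_conj]
  congr 2
  rw [EuclideanSpace.norm_sq_eq]
  simp [G, mulVec_diagonal, mul_pow]

theorem R_eq_diagonal : S.R = diagonal fun n => (S.rdiag n : ℂ) := by
  ext i j
  by_cases hij : i = j
  · subst hij
    simp [R, H, rdiag, Matrix.sum_apply, Matrix.add_apply, Complex.conj_mul']
  · simp [R, H, Matrix.sum_apply, Matrix.add_apply, hij]

theorem trR_eq : S.trR = ∑ n, S.rdiag n := by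
  rw [trR, R_eq_diagonal, trace_diagonal, ← Complex.ofReal_sum, Complex.ofReal_re]

theorem outPower_eq_quad (γ : EuclideanSpace ℂ (Fin N)) : S.outPower γ = quad S.R γ := by
  rw [outPower, mul_vecMulVec, trace_vecMulVec, dotProduct_comm]
  rfl

theorem posSemidef_XB (hp : ∀ k, 0 ≤ S.p k) (k : Fin K) : (S.XB k).PosSemidef :=
  posSemidef_ofReal_smul (posSemidef_conj _ _) (hp k)

theorem posSemidef_MB (k : Fin K) : (S.MB k).PosSemidef := posSemidef_conj _ _

theorem posSemidef_XE (hp : ∀ k, 0 ≤ S.p k) (k : Fin K) : (S.XE k).PosSemidef :=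
  posSemidef_ofReal_smul (posSemidef_conj _ _) (hp k)

theorem posSemidef_YB (hp : ∀ k, 0 ≤ S.p k) (hRIS : 0 < S.varRIS) (k : Fin K) :
    (S.YB k).PosSemidef :=
  (posSemidef_ofReal_smul (posSemidef_diagonal_ofReal fun _ => by positivity) hRIS.le).add
    (posSemidef_sum _ fun m _ => posSemidef_ofReal_smul (posSemidef_conj _ _) (hp m))

theorem posSemidef_ME (hp : ∀ k, 0 ≤ S.p k) (hRIS : 0 < S.varRIS) (k : Fin K) :
    (S.ME k).PosSemidef :=
  (posSemidef_sum _ fun m _ => posSemidef_ofReal_smul (posSemidef_conj _ _) (hp m)).add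
    (posSemidef_ofReal_smul (posSemidef_self_mul_conjTranspose _) hRIS.le)

theorem varRIS_le_rdiag (hp : ∀ k, 0 ≤ S.p k) (n : Fin N) : S.varRIS ≤ S.rdiag n :=
  le_add_of_nonneg_left (Finset.sum_nonneg fun k _ => mul_nonneg (hp k) (by positivity))

theorem posSemidef_R (hp : ∀ k, 0 ≤ S.p k) (hRIS : 0 < S.varRIS) : S.R.PosSemidef := by
  rw [R_eq_diagonal]
  exact posSemidef_diagonal_ofReal fun n => hRIS.le.trans (S.varRIS_le_rdiag hp n)

/-- Coercivity from the RIS noise alone: it bounds the feasible set and serves as the modulus of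
strong convexity. -/
theorem le_quad_R (hp : ∀ k, 0 ≤ S.p k) (γ : EuclideanSpace ℂ (Fin N)) :
    S.varRIS * ‖γ‖ ^ 2 ≤ quad S.R γ := by
  rw [R_eq_diagonal, quad_diagonal, EuclideanSpace.norm_sq_eq, Finset.mul_sum]
  exact Finset.sum_le_sum fun n _ =>
    mul_le_mul_of_nonneg_right (S.varRIS_le_rdiag hp n) (by positivity)

theorem xB_nonneg (hp : ∀ k, 0 ≤ S.p k) (k : Fin K) (γ : EuclideanSpace ℂ (Fin N)) :
    0 ≤ S.xB k γ := mul_nonneg (hp k) (by positivity)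

theorem xE_nonneg (hp : ∀ k, 0 ≤ S.p k) (k : Fin K) (γ : EuclideanSpace ℂ (Fin N)) :
    0 ≤ S.xE k γ := mul_nonneg (hp k) (by positivity)

theorem yE_nonneg (hp : ∀ k, 0 ≤ S.p k) (hRIS : 0 < S.varRIS) (k : Fin K)
    (γ : EuclideanSpace ℂ (Fin N)) : 0 ≤ S.yE k γ := by
  rw [yE_eq_quad]; exact quad_nonneg (S.posSemidef_ME hp hRIS k) γ

theorem yB_pos (hp : ∀ k, 0 ≤ S.p k) (hB : 0 < S.varB) (hRIS : 0 < S.varRIS) {k : Fin K}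
    (hc : S.c k ≠ 0) (γ : EuclideanSpace ℂ (Fin N)) : 0 < S.yB k γ := by
  rw [yB_eq_quad]
  have := quad_nonneg (S.posSemidef_YB hp hRIS k) γ
  have : 0 < ‖S.c k‖ := norm_pos_iff.2 hc
  positivity

theorem yB_eq_zero {k : Fin K} (hc : S.c k = 0) (γ : EuclideanSpace ℂ (Fin N)) :
    S.yB k γ = 0 := by
  simp [yB, quad, U, ampB, hc]

/-- Diagonal matrices let `γ` and `u = G_Bᴴ c_k` exchange roles: both sides contain `∑ |γ_n|²
|u_n|²`. -/
theorem noiseB_eq (k : Fin K) (γ : EuclideanSpace ℂ (Fin N)) :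
    (star (S.c k).ofLp ⬝ᵥ (S.W γ *ᵥ (S.c k).ofLp)).re =
      S.varB * ‖S.c k‖ ^ 2 + S.varRIS * quad (S.U k) γ := by
  have h1 : (star (S.c k).ofLp ⬝ᵥ (S.c k).ofLp).re = ‖S.c k‖ ^ 2 := by
    rw [EuclideanSpace.norm_sq_eq]
    simp only [dotProduct, Complex.re_sum, Pi.star_apply]
    refine Finset.sum_congr rfl fun n _ => ?_
    rw [← Complex.normSq_eq_norm_sq]
    simp [Complex.normSq_apply]
  have h2 : (star (S.c k).ofLp ⬝ᵥ ((S.GB * Gam γ * (Gam γ)ᴴ * S.GBᴴ) *ᵥ (S.c k).ofLp)).re =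
      quad (S.U k) γ := by
    have h3 : star (S.c k).ofLp ⬝ᵥ ((S.GB * Gam γ * (Gam γ)ᴴ * S.GBᴴ) *ᵥ (S.c k).ofLp) =
        star (S.GBᴴ *ᵥ (S.c k).ofLp) ⬝ᵥ
          ((Gam γ * (Gam γ)ᴴ) *ᵥ (S.GBᴴ *ᵥ (S.c k).ofLp)) := by
      rw [star_mulVec, conjTranspose_conjTranspose, mulVec_mulVec, ← dotProduct_mulVec,
        mulVec_mulVec, Matrix.mul_assoc, Matrix.mul_assoc, Matrix.mul_assoc]
    rw [h3]
    have h4 := quad_diagonal_mul_conj γ (WithLp.toLp 2 (S.GBᴴ *ᵥ (S.c k).ofLp))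
    simp only [quad] at h4
    rw [Gam, h4, U, quad_diagonal]
    exact Finset.sum_congr rfl fun n _ => mul_comm _ _
  simp [W, add_mulVec, dotProduct_add, smul_mulVec, dotProduct_smul, h1, h2]

theorem sinrB_eq (k : Fin K) (γ : EuclideanSpace ℂ (Fin N)) :
    S.sinrB k γ = S.xB k γ / S.yB k γ := by
  rw [sinrB, noiseB_eq]; rfl

theorem sinrE_eq (k : Fin K) (γ : EuclideanSpace ℂ (Fin N)) :
    S.sinrE k γ = S.xE k γ / (S.yE k γ + S.varE) := by
  have h : (star S.g.ofLp ⬝ᵥ ((Gam γ * (Gam γ)ᴴ) *ᵥ S.g.ofLp)).re =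
      ‖WithLp.toLp 2 (S.G *ᵥ γ.ofLp)‖ ^ 2 := by
    have := quad_diagonal_mul_conj γ S.g
    simp only [quad] at this
    rw [Gam, this, EuclideanSpace.norm_sq_eq]
    simp [G, mulVec_diagonal, mul_pow, mul_comm]
  rw [sinrE, h, xE, yE]
  congr 1
  ring

/-- Numerator and denominator of `1 + sinrE` are normalised by `varE` separately, so that each
logarithm admits its own concave minorant. -/
theorem log_one_add_sinrE (hp : ∀ k, 0 ≤ S.p k) (hE : 0 < S.varE) (hRIS : 0 < S.varRIS)
    (k : Fin K) (γ : EuclideanSpace ℂ (Fin N)) :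
    -Real.log (1 + S.sinrE k γ) = Real.log (1 + S.yE k γ / S.varE) +
      Real.log (S.varE / (S.varE + (S.xE k γ + S.yE k γ))) := by
  have hx := S.xE_nonneg hp k γ
  have hy := S.yE_nonneg hp hRIS k γ
  rw [sinrE_eq, ← Real.log_inv, ← Real.log_mul (by positivity) (by positivity)]
  congr 1
  field_simp
  ring

/-- The prefactor cancels all square roots, leaving a term linear in `l`. For `q = 0` the left side
is `0` by the prefactor, and `hl` makes the right side agree, so no singularity remains. -/
theorem mul_sqrt_expansion {p q l y s : ℝ} (hp : 0 ≤ p) (hq : 0 ≤ q) (hl : q = 0 → l = 0) :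
    p * q / y * (2 * (√p * (√q + (l - q) / √q)) / √(p * q) - s - 1) =
      2 * (p * l) / y - p * q / y * s - p * q / y := by
  rcases hp.eq_or_lt with rfl | hp'
  · simp
  rcases hq.eq_or_lt with rfl | hq'
  · simp [hl rfl]
  have hsp : √p ≠ 0 := (Real.sqrt_pos.2 hp').ne'
  have hsq : √q ≠ 0 := (Real.sqrt_pos.2 hq').ne'
  have e1 : √q + (l - q) / √q = l / √q := by
    field_simp
    rw [Real.sq_sqrt hq]; ring
  have e2 : 2 * (√p * (√q + (l - q) / √q)) / √(p * q) = 2 * l / q := by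
    rw [e1, Real.sqrt_mul hp]
    field_simp
    rw [Real.sq_sqrt hq]
  rw [e2]
  field_simp

/-- The surrogate rate without square roots, in natural logarithms. -/
theorem rateTilde_eq (hp : ∀ k, 0 ≤ S.p k) (hRIS : 0 < S.varRIS) (k : Fin K)
    (γb γ : EuclideanSpace ℂ (Fin N)) :
    S.rateTilde k γb γ = 1 / Real.log 2 *
      ((Real.log (1 + S.xB k γb / S.yB k γb) +
        (2 * blin (S.XB k) γb γ / S.yB k γb - S.xB k γb / S.yB k γb *
          ((S.xB k γ + S.yB k γ) / (S.xB k γb + S.yB k γb)) - S.xB k γb / S.yB k γb)) +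
      (Real.log (1 + S.yE k γb / S.varE) +
        (2 * blin (S.ME k) γb γ / S.varE - S.yE k γb / S.varE *
          ((S.yE k γ + S.varE) / (S.yE k γb + S.varE)) - S.yE k γb / S.varE)) +
      (Real.log (S.varE / (S.varE + (S.xE k γb + S.yE k γb))) -
        ((S.xE k γ + S.yE k γ) - (S.xE k γb + S.yE k γb)) /
          (S.varE + (S.xE k γb + S.yE k γb)))) := by
  have hMB := S.posSemidef_MB k
  have hME := S.posSemidef_ME hp hRIS k
  have e1 := mul_sqrt_expansion (p := S.p k) (y := S.yB k γb)
    (s := (S.xB k γ + S.yB k γ) / (S.xB k γb + S.yB k γb)) (hp k) (quad_nonneg hMB γb)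
    (fun h => blin_eq_zero hMB h γ)
  have e2 := mul_sqrt_expansion (p := 1) (y := S.varE)
    (s := (S.yE k γ + S.varE) / (S.yE k γb + S.varE)) zero_le_one (quad_nonneg hME γb)
    (fun h => blin_eq_zero hME h γ)
  have hx : S.p k * quad (S.MB k) γb = S.xB k γb := by rw [xB_eq_quad, XB, quad_smul_matrix]
  have hb : S.p k * blin (S.MB k) γb γ = blin (S.XB k) γb γ := by rw [XB, blin_smul_matrix]
  rw [hx, hb, ← lin_eq] at e1
  rw [one_mul, one_mul, Real.sqrt_one, one_mul, ← lin_eq, ← yE_eq_quad] at e2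
  have e3 : S.xTilde k γb γ = √(S.p k) * (√(quad (S.MB k) γb) +
    lin (S.MB k) γb γ / √(quad (S.MB k) γb)) := rfl
  have e4 : S.yTilde k γb γ = √(S.yE k γb) + lin (S.ME k) γb γ / √(S.yE k γb) := by
    rw [yTilde, yE_eq_quad]
  rw [← e3] at e1
  rw [← e4] at e2
  rw [rateTilde, e1, e2]
  simp only [Real.logb, add_assoc]
  ring

/-- The secrecy sum-rate in natural logarithms. -/
theorem ssr_eq (hp : ∀ k, 0 ≤ S.p k) (hE : 0 < S.varE) (hRIS : 0 < S.varRIS)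
    (γ : EuclideanSpace ℂ (Fin N)) :
    S.ssr γ = ∑ k, 1 / Real.log 2 * (Real.log (1 + S.xB k γ / S.yB k γ) +
      Real.log (1 + S.yE k γ / S.varE) +
      Real.log (S.varE / (S.varE + (S.xE k γ + S.yE k γ)))) := by
  refine Finset.sum_congr rfl fun k _ => ?_
  rw [add_assoc, ← S.log_one_add_sinrE hp hE hRIS, sinrB_eq]
  simp only [Real.logb]
  ring

/-! ### Properties of the surrogate numerator -/

theorem ssrTilde_le_ssr (hp : ∀ k, 0 ≤ S.p k) (hB : 0 < S.varB) (hE : 0 < S.varE)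
    (hRIS : 0 < S.varRIS) (γb γ : EuclideanSpace ℂ (Fin N)) :
    S.ssrTilde γb γ ≤ S.ssr γ := by
  rw [S.ssr_eq hp hE hRIS, ssrTilde]
  refine Finset.sum_le_sum fun k _ => ?_
  rw [S.rateTilde_eq hp hRIS]
  refine mul_le_mul_of_nonneg_left ?_ (by positivity)
  have hXB := S.posSemidef_XB hp k
  have hME := S.posSemidef_ME hp hRIS k
  refine add_le_add (add_le_add ?_ ?_) ?_
  -- For a zero filter `yB` vanishes, and division by zero makes both sides `0`.
  · by_cases hc : S.c k = 0
    · simp [S.yB_eq_zero hc]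
    · refine le_log_one_add_div (S.xB_nonneg hp k γ) (S.yB_pos hp hB hRIS hc γ)
        (S.xB_nonneg hp k γb) (S.yB_pos hp hB hRIS hc γb) fun t => ?_
      simpa only [xB_eq_quad] using quad_sub_smul_nonneg hXB t γb γ
  · refine le_log_one_add_div (S.yE_nonneg hp hRIS k γ) hE (S.yE_nonneg hp hRIS k γb) hE
      fun t => ?_
    simpa only [yE_eq_quad] using quad_sub_smul_nonneg hME t γb γ
  · exact le_log_div_add hE (add_nonneg (S.xE_nonneg hp k γ) (S.yE_nonneg hp hRIS k γ))
      (add_nonneg (S.xE_nonneg hp k γb) (S.yE_nonneg hp hRIS k γb))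

theorem ssrTilde_self (hp : ∀ k, 0 ≤ S.p k) (hB : 0 < S.varB) (hE : 0 < S.varE)
    (hRIS : 0 < S.varRIS) (γ : EuclideanSpace ℂ (Fin N)) :
    S.ssrTilde γ γ = S.ssr γ := by
  rw [S.ssr_eq hp hE hRIS, ssrTilde]
  refine Finset.sum_congr rfl fun k _ => ?_
  rw [S.rateTilde_eq hp hRIS, blin_self, blin_self, ← xB_eq_quad, ← yE_eq_quad]
  have hyE := S.yE_nonneg hp hRIS k γ
  congr 1
  have e1 : 2 * S.xB k γ / S.yB k γ -
      S.xB k γ / S.yB k γ * ((S.xB k γ + S.yB k γ) / (S.xB k γ + S.yB k γ)) -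
      S.xB k γ / S.yB k γ = 0 := by
    by_cases hc : S.c k = 0
    · simp [S.yB_eq_zero hc]
    · have hx := S.xB_nonneg hp k γ
      have hy := S.yB_pos hp hB hRIS hc γ
      rw [div_self (by positivity)]
      ring
  have e2 : 2 * S.yE k γ / S.varE -
      S.yE k γ / S.varE * ((S.yE k γ + S.varE) / (S.yE k γ + S.varE)) -
      S.yE k γ / S.varE = 0 := by
    rw [div_self (by positivity)]
    ring
  rw [e1, e2]
  simp

theorem concaveOn_ssrTilde (hp : ∀ k, 0 ≤ S.p k) (hB : 0 < S.varB) (hE : 0 < S.varE)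
    (hRIS : 0 < S.varRIS) (γb : EuclideanSpace ℂ (Fin N)) :
    ConcaveOn ℝ Set.univ (S.ssrTilde γb) := by
  refine ⟨convex_univ, fun a _ b _ s t hs ht hst => ?_⟩
  simp only [ssrTilde, smul_eq_mul, Finset.mul_sum, ← Finset.sum_add_distrib]
  refine Finset.sum_le_sum fun k _ => ?_
  have hxB := S.xB_nonneg hp k γb
  have hyB : 0 ≤ S.yB k γb := by
    by_cases hc : S.c k = 0
    · rw [S.yB_eq_zero hc]
    · exact (S.yB_pos hp hB hRIS hc γb).le
  have hxE := S.xE_nonneg hp k γb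
  have hyE := S.yE_nonneg hp hRIS k γb
  have h1 := quad_nonneg (S.posSemidef_XB hp k) (a - b)
  have h2 := quad_nonneg (S.posSemidef_YB hp hRIS k) (a - b)
  have h3 := quad_nonneg (S.posSemidef_XE hp k) (a - b)
  have h4 := quad_nonneg (S.posSemidef_ME hp hRIS k) (a - b)
  -- The linear parts combine exactly; only the subtracted forms contribute a defect, and their
  -- coefficients are nonnegative.
  have key : S.rateTilde k γb (s • a + t • b) =
      s * S.rateTilde k γb a + t * S.rateTilde k γb b + s * t * (1 / Real.log 2 *
        (S.xB k γb / S.yB k γb *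
          ((quad (S.XB k) (a - b) + quad (S.YB k) (a - b)) / (S.xB k γb + S.yB k γb)) +
        S.yE k γb / S.varE * (quad (S.ME k) (a - b) / (S.yE k γb + S.varE)) +
        (quad (S.XE k) (a - b) + quad (S.ME k) (a - b)) /
          (S.varE + (S.xE k γb + S.yE k γb)))) := by
    simp only [S.rateTilde_eq hp hRIS]
    generalize S.xB k γb / S.yB k γb = u
    generalize S.yE k γb / S.varE = u'
    generalize S.xB k γb + S.yB k γb = w
    generalize S.yE k γb + S.varE = w'
    generalize S.xE k γb + S.yE k γb = w''
    simp only [xB_eq_quad, yB_eq_quad, xE_eq_quad, yE_eq_quad, quad_combo _ hst,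
      blin_add_right, blin_smul_right]
    obtain rfl : t = 1 - s := by linarith
    ring
  rw [key]
  exact le_add_of_nonneg_right (by positivity)

/-! ### Regularity of the surrogate and of the secrecy rate -/

theorem differentiable_xB (k : Fin K) : Differentiable ℝ (S.xB k) := by
  simpa only [funext (S.xB_eq_quad k)] using differentiable_quad (S.XB k)

theorem differentiable_yB (k : Fin K) : Differentiable ℝ (S.yB k) := by
  simpa only [funext (S.yB_eq_quad k)] using (differentiable_quad (S.YB k)).const_add _

theorem differentiable_xE (k : Fin K) : Differentiable ℝ (S.xE k) := by
  simpa only [funext (S.xE_eq_quad k)] using differentiable_quad (S.XE k)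

theorem differentiable_yE (k : Fin K) : Differentiable ℝ (S.yE k) := by
  simpa only [funext (S.yE_eq_quad k)] using differentiable_quad (S.ME k)

theorem differentiable_ssrTilde (hp : ∀ k, 0 ≤ S.p k) (hRIS : 0 < S.varRIS)
    (γb : EuclideanSpace ℂ (Fin N)) : Differentiable ℝ (S.ssrTilde γb) := by
  refine Differentiable.fun_sum (A := fun k γ => S.rateTilde k γb γ) fun k _ => ?_
  simp only [S.rateTilde_eq hp hRIS]
  have h1 := S.differentiable_xB k
  have h2 := S.differentiable_yB k
  have h3 := S.differentiable_xE k
  have h4 := S.differentiable_yE k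
  have h5 := differentiable_blin_right (S.XB k) γb
  have h6 := differentiable_blin_right (S.ME k) γb
  -- All denominators are frozen at `γb`, so no nonvanishing condition arises.
  simp only [div_eq_mul_inv]
  fun_prop

/-- Continuity in the base point for a fixed competitor is what transfers an improvement at a
cluster point to nearby iterates. -/
theorem continuous_ssrTilde_left (hp : ∀ k, 0 ≤ S.p k) (hB : 0 < S.varB) (hE : 0 < S.varE)
    (hRIS : 0 < S.varRIS) (γ : EuclideanSpace ℂ (Fin N)) :
    Continuous fun γb => S.ssrTilde γb γ := by
  unfold ssrTilde
  refine continuous_finsetSum _ fun k _ => ?_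
  simp only [S.rateTilde_eq hp hRIS]
  have h1 := (S.differentiable_xB k).continuous
  have h2 := (S.differentiable_yB k).continuous
  have h3 := (S.differentiable_xE k).continuous
  have h4 := (S.differentiable_yE k).continuous
  have h5 := continuous_blin_left (S.XB k) γ
  have h6 := continuous_blin_left (S.ME k) γ
  have n1 := S.xB_nonneg hp k
  have n3 := S.xE_nonneg hp k
  have n4 := S.yE_nonneg hp hRIS k
  refine continuous_const.mul (Continuous.add (Continuous.add ?_ ?_) ?_)
  · by_cases hc : S.c k = 0
    · simp only [S.yB_eq_zero hc, div_zero, zero_mul]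
      fun_prop
    · have n2 := S.yB_pos hp hB hRIS hc
      have n2' : ∀ γb, S.yB k γb ≠ 0 := fun γb => (n2 γb).ne'
      have d := h1.div h2 n2'
      refine (Continuous.log (continuous_const.add d) fun γb => ?_).add
        ((((continuous_const.mul h5).div h2 n2').sub
          (d.mul (continuous_const.div (h1.add h2) fun γb => ?_))).sub d)
      · exact (add_pos_of_pos_of_nonneg one_pos (div_nonneg (n1 γb) (n2 γb).le)).ne'
      · exact (add_pos_of_nonneg_of_pos (n1 γb) (n2 γb)).ne'
  · have d := h4.div_const S.varE
    refine (Continuous.log (continuous_const.add d) fun γb => ?_).add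
      ((((continuous_const.mul h6).div_const _).sub
        (d.mul (continuous_const.div (h4.add continuous_const) fun γb => ?_))).sub d)
    · exact (add_pos_of_pos_of_nonneg one_pos (div_nonneg (n4 γb) hE.le)).ne'
    · exact (add_pos_of_nonneg_of_pos (n4 γb) hE).ne'
  · have d : ∀ γb, S.varE + (S.xE k γb + S.yE k γb) ≠ 0 := fun γb => by
      have := n3 γb; have := n4 γb; positivity
    have e := (continuous_const (y := S.varE)).add (h3.add h4)
    refine (Continuous.log (continuous_const.div e d) fun γb => ?_).sub
      ((continuous_const.sub (h3.add h4)).div e d)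
    exact div_ne_zero hE.ne' (d γb)

theorem differentiable_ssr (hp : ∀ k, 0 ≤ S.p k) (hB : 0 < S.varB) (hE : 0 < S.varE)
    (hRIS : 0 < S.varRIS) : Differentiable ℝ S.ssr := by
  rw [funext (S.ssr_eq hp hE hRIS)]
  refine Differentiable.fun_sum fun k _ => ?_
  have h1 := S.differentiable_xB k
  have h2 := S.differentiable_yB k
  have h3 := S.differentiable_xE k
  have h4 := S.differentiable_yE k
  have n1 := S.xB_nonneg hp k
  have n3 := S.xE_nonneg hp k
  have n4 := S.yE_nonneg hp hRIS k
  refine Differentiable.const_mul (Differentiable.add (Differentiable.add ?_ ?_) ?_) _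
  · by_cases hc : S.c k = 0
    · simp [S.yB_eq_zero hc]
    · have n2 := S.yB_pos hp hB hRIS hc
      simp only [div_eq_mul_inv]
      refine Differentiable.log ((h1.mul (h2.inv fun γ => (n2 γ).ne')).const_add _) fun γ => ?_
      exact (add_pos_of_pos_of_nonneg one_pos (mul_nonneg (n1 γ) (inv_nonneg.2 (n2 γ).le))).ne'
  · simp only [div_eq_mul_inv]
    refine Differentiable.log ((h4.mul_const _).const_add _) fun γ => ?_
    exact (add_pos_of_pos_of_nonneg one_pos (mul_nonneg (n4 γ) (inv_nonneg.2 hE.le))).ne'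
  · have d : ∀ γ, S.varE + (S.xE k γ + S.yE k γ) ≠ 0 := fun γ => by
      have := n3 γ; have := n4 γ; positivity
    simp only [div_eq_mul_inv]
    exact Differentiable.log ((((h3.add h4).const_add _).inv d).const_mul _)
      fun γ => mul_ne_zero hE.ne' (inv_ne_zero (d γ))

/-! ### The power constraints and the denominator -/

theorem differentiable_outPower : Differentiable ℝ S.outPower := by
  simpa only [funext S.outPower_eq_quad] using differentiable_quad S.R

theorem differentiable_totalPower : Differentiable ℝ S.totalPower :=
  S.differentiable_outPower.add_const _

theorem mem_feasible {γ : EuclideanSpace ℂ (Fin N)} :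
    γ ∈ S.feasible ↔ S.trR ≤ S.outPower γ ∧ S.outPower γ ≤ S.PRmax + S.trR := by
  simp [feasible, constr, Fin.forall_fin_two]

theorem feasible_nonempty (hPR : 0 < S.PRmax) : S.feasible.Nonempty := by
  -- Since `R` is diagonal, the all-ones vector has output power exactly `trR`.
  refine ⟨WithLp.toLp 2 fun _ => 1, S.mem_feasible.2 ?_⟩
  have h : S.outPower (WithLp.toLp 2 fun _ => 1) = S.trR := by
    rw [outPower_eq_quad, R_eq_diagonal, quad_diagonal, trR_eq]
    simp
  rw [h]
  exact ⟨le_rfl, by linarith⟩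

/-- The lower power constraint compensates the `-trR` in `Pceq`. -/
theorem totalPower_pos (hp : ∀ k, 0 ≤ S.p k) (hμ : ∀ k, 0 ≤ S.μ k) (hPc : 0 < S.Pc)
    {γ : EuclideanSpace ℂ (Fin N)} (hγ : γ ∈ S.feasible) : 0 < S.totalPower γ := by
  have h1 := (S.mem_feasible.1 hγ).1
  have h2 : 0 ≤ ∑ k, S.μ k * S.p k := Finset.sum_nonneg fun k _ => mul_nonneg (hμ k) (hp k)
  rw [totalPower, Pceq]
  linarith

theorem totalPower_le {γ : EuclideanSpace ℂ (Fin N)} (hγ : γ ∈ S.feasible) :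
    S.totalPower γ ≤ S.PRmax + S.trR + S.Pceq := by
  have h1 := (S.mem_feasible.1 hγ).2
  rw [totalPower]
  linarith

theorem convexOn_outPower (hp : ∀ k, 0 ≤ S.p k) (hRIS : 0 < S.varRIS) :
    ConvexOn ℝ Set.univ S.outPower := by
  rw [funext S.outPower_eq_quad]
  exact convexOn_quad (S.posSemidef_R hp hRIS)

theorem convexOn_totalPower (hp : ∀ k, 0 ≤ S.p k) (hRIS : 0 < S.varRIS) :
    ConvexOn ℝ Set.univ S.totalPower :=
  (S.convexOn_outPower hp hRIS).add (convexOn_const _ convex_univ)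

theorem linearised_eq (γb γ : EuclideanSpace ℂ (Fin N)) :
    quad S.R γb + 2 * lin S.R γb γ = 2 * blin S.R γb γ - quad S.R γb := by
  rw [lin_eq]; ring

theorem self_mem_feasibleTilde {γb : EuclideanSpace ℂ (Fin N)} (h : γb ∈ S.feasible) :
    γb ∈ S.feasibleTilde γb := by
  obtain ⟨h1, h2⟩ := S.mem_feasible.1 h
  refine ⟨h2, ?_⟩
  rw [linearised_eq, blin_self, ← outPower_eq_quad]
  linarith

/-- A convex form lies above its tangent, by nonnegativity at `γ - γb`. -/
theorem feasibleTilde_subset (hp : ∀ k, 0 ≤ S.p k) (hRIS : 0 < S.varRIS)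
    (γb : EuclideanSpace ℂ (Fin N)) : S.feasibleTilde γb ⊆ S.feasible := by
  rintro γ ⟨h1, h2⟩
  refine S.mem_feasible.2 ⟨h2.trans ?_, h1⟩
  have := quad_sub_smul_nonneg (S.posSemidef_R hp hRIS) 1 γb γ
  rw [linearised_eq, outPower_eq_quad]
  linarith

theorem convex_feasibleTilde (hp : ∀ k, 0 ≤ S.p k) (hRIS : 0 < S.varRIS)
    (γb : EuclideanSpace ℂ (Fin N)) : Convex ℝ (S.feasibleTilde γb) := by
  intro a ha b hb s t hs ht hst
  refine ⟨((S.convexOn_outPower hp hRIS).2 trivial trivial hs ht hst).trans ?_, ?_⟩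
  · have h1 := mul_le_mul_of_nonneg_left ha.1 hs
    have h2 := mul_le_mul_of_nonneg_left hb.1 ht
    have h3 : s * (S.PRmax + S.trR) + t * (S.PRmax + S.trR) = S.PRmax + S.trR := by
      rw [← add_mul, hst, one_mul]
    simp only [smul_eq_mul]
    linarith
  · have h1 := mul_le_mul_of_nonneg_left ha.2 hs
    have h2 := mul_le_mul_of_nonneg_left hb.2 ht
    simp only [linearised_eq, blin_add_right, blin_smul_right] at h1 h2 ⊢
    have h3 : s * S.trR + t * S.trR = S.trR := by rw [← add_mul, hst, one_mul]
    have h4 : s * quad S.R γb + t * quad S.R γb = quad S.R γb := by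
      rw [← add_mul, hst, one_mul]
    linarith

theorem isCompact_feasible (hp : ∀ k, 0 ≤ S.p k) (hRIS : 0 < S.varRIS) :
    IsCompact S.feasible := by
  have hc := S.differentiable_outPower.continuous
  refine Metric.isCompact_of_isClosed_isBounded ?_ ?_
  · have : S.feasible = {γ | S.trR ≤ S.outPower γ} ∩ {γ | S.outPower γ ≤ S.PRmax + S.trR} :=
      Set.ext fun γ => S.mem_feasible
    rw [this]
    exact (isClosed_le continuous_const hc).inter (isClosed_le hc continuous_const)
  · refine (Metric.isBounded_closedBall (x := (0 : EuclideanSpace ℂ (Fin N)))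
      (r := √((S.PRmax + S.trR) / S.varRIS))).subset fun γ hγ => ?_
    rw [mem_closedBall_zero_iff]
    refine Real.le_sqrt_of_sq_le ?_
    rw [le_div_iff₀ hRIS, mul_comm]
    refine (S.le_quad_R hp γ).trans ?_
    rw [← outPower_eq_quad]
    exact (S.mem_feasible.1 hγ).2

theorem isCompact_feasibleTilde (hp : ∀ k, 0 ≤ S.p k) (hRIS : 0 < S.varRIS)
    (γb : EuclideanSpace ℂ (Fin N)) : IsCompact (S.feasibleTilde γb) := by
  refine (S.isCompact_feasible hp hRIS).of_isClosed_subset ?_ (S.feasibleTilde_subset hp hRIS γb)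
  have h : S.feasibleTilde γb = {γ | S.outPower γ ≤ S.PRmax + S.trR} ∩
      {γ | S.trR ≤ 2 * blin S.R γb γ - quad S.R γb} := by
    ext γ
    simp only [← linearised_eq]
    rfl
  rw [h]
  exact (isClosed_le S.differentiable_outPower.continuous continuous_const).inter
    (isClosed_le continuous_const
      ((continuous_const.mul (differentiable_blin_right S.R γb).continuous).sub continuous_const))

theorem exists_isSubproblemSolution (hp : ∀ k, 0 ≤ S.p k) (hμ : ∀ k, 0 ≤ S.μ k)
    (hRIS : 0 < S.varRIS) (hPc : 0 < S.Pc) {γb : EuclideanSpace ℂ (Fin N)}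
    (hγb : γb ∈ S.feasible) : ∃ γs, S.IsSubproblemSolution γb γs := by
  refine (S.isCompact_feasibleTilde hp hRIS γb).exists_isMaxOn
    ⟨γb, S.self_mem_feasibleTilde hγb⟩ (ContinuousOn.div
      (S.differentiable_ssrTilde hp hRIS γb).continuous.continuousOn
      S.differentiable_totalPower.continuous.continuousOn fun γ hγ => ?_)
  exact (S.totalPower_pos hp hμ hPc (S.feasibleTilde_subset hp hRIS γb hγ)).ne'

/-! ### Surrogate solutions and the KKT conditions -/

/-- A functional that is nonpositive on an open half-space is a nonpositive multiple of the
functional defining it. -/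
theorem eq_neg_smul_of_nonpos {E : Type*} [NormedAddCommGroup E] [NormedSpace ℝ E]
    {D q : E →L[ℝ] ℝ} {u : E} (hu : 0 < q u) (h : ∀ d, 0 < q d → D d ≤ 0) :
    ∃ l : ℝ, 0 ≤ l ∧ D = -(l • q) := by
  refine ⟨-D u / q u, div_nonneg (by linarith [h u hu]) hu.le, ?_⟩
  have key : ∀ d, D (d - (q d / q u) • u) ≤ 0 := by
    intro d
    by_contra hd
    push Not at hd
    set w := d - (q d / q u) • u with hw
    have hqw : q w = 0 := by
      rw [hw]
      simp only [map_sub, map_smul, smul_eq_mul]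
      field_simp
      ring
    -- Adding a multiple of `w ∈ ker q` to `u` stays in the half-space; this multiple gives `D` the
    -- value `D w > 0`.
    have h1 : D ((-D u / D w + 1) • w + u) ≤ 0 := h _ (by simpa [hqw] using hu)
    simp only [map_add, map_smul, smul_eq_mul, add_mul, one_mul] at h1
    rw [div_mul_cancel₀ _ hd.ne'] at h1
    linarith
  ext d
  have h1 := key d
  have h2 := key (-d)
  simp only [map_sub, map_smul, map_neg, smul_eq_mul] at h1 h2
  simp only [_root_.neg_apply, _root_.smul_apply, smul_eq_mul]
  have h3 : -(-D u / q u * q d) = q d / q u * D u := by ring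
  have h4 : -q d / q u * D u = -(q d / q u * D u) := by ring
  rw [h3]
  linarith

/-- Objective of the surrogate problem. -/
def seeTilde (γb γ : EuclideanSpace ℂ (Fin N)) : ℝ := S.ssrTilde γb γ / S.totalPower γ

/-- Points at which both constraints of the surrogate problem hold strictly. -/
def strictFeasibleTilde (γb : EuclideanSpace ℂ (Fin N)) : Set (EuclideanSpace ℂ (Fin N)) :=
  {γ | S.outPower γ < S.PRmax + S.trR ∧ S.trR < quad S.R γb + 2 * lin S.R γb γ}

theorem strictFeasibleTilde_subset (γb : EuclideanSpace ℂ (Fin N)) :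
    S.strictFeasibleTilde γb ⊆ S.feasibleTilde γb := fun _ h => ⟨h.1.le, h.2.le⟩

theorem seeTilde_self (hp : ∀ k, 0 ≤ S.p k) (hB : 0 < S.varB) (hE : 0 < S.varE)
    (hRIS : 0 < S.varRIS) (γ : EuclideanSpace ℂ (Fin N)) :
    S.B * S.seeTilde γ γ = S.see γ := by
  rw [seeTilde, S.ssrTilde_self hp hB hE hRIS, see]

theorem seeTilde_le (hp : ∀ k, 0 ≤ S.p k) (hB : 0 < S.varB) (hE : 0 < S.varE)
    (hRIS : 0 < S.varRIS) (hBw : 0 < S.B) (γb : EuclideanSpace ℂ (Fin N))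
    {γ : EuclideanSpace ℂ (Fin N)} (hγ : 0 < S.totalPower γ) :
    S.B * S.seeTilde γb γ ≤ S.see γ :=
  mul_le_mul_of_nonneg_left
    (div_le_div_of_nonneg_right (S.ssrTilde_le_ssr hp hB hE hRIS γb γ) hγ.le) hBw.le

theorem differentiableAt_div_totalPower {f : EuclideanSpace ℂ (Fin N) → ℝ}
    (hf : Differentiable ℝ f) {γ : EuclideanSpace ℂ (Fin N)} (hγ : 0 < S.totalPower γ) :
    DifferentiableAt ℝ (fun γ => f γ / S.totalPower γ) γ := by
  simp only [div_eq_mul_inv]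
  exact (hf γ).mul ((S.differentiable_totalPower γ).inv hγ.ne')

theorem differentiableAt_see (hp : ∀ k, 0 ≤ S.p k) (hB : 0 < S.varB) (hE : 0 < S.varE)
    (hRIS : 0 < S.varRIS) {γ : EuclideanSpace ℂ (Fin N)} (hγ : 0 < S.totalPower γ) :
    DifferentiableAt ℝ S.see γ :=
  (S.differentiableAt_div_totalPower (S.differentiable_ssr hp hB hE hRIS) hγ).const_mul _

theorem differentiableAt_seeTilde (hp : ∀ k, 0 ≤ S.p k) (hRIS : 0 < S.varRIS)
    (γb : EuclideanSpace ℂ (Fin N)) {γ : EuclideanSpace ℂ (Fin N)} (hγ : 0 < S.totalPower γ) :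
    DifferentiableAt ℝ (S.seeTilde γb) γ :=
  S.differentiableAt_div_totalPower (S.differentiable_ssrTilde hp hRIS γb) hγ

/-- The surrogate touches the objective from below, so the gradients agree. -/
theorem fderiv_see (hp : ∀ k, 0 ≤ S.p k) (hB : 0 < S.varB) (hE : 0 < S.varE)
    (hRIS : 0 < S.varRIS) (hBw : 0 < S.B) {γ : EuclideanSpace ℂ (Fin N)}
    (hγ : 0 < S.totalPower γ) : fderiv ℝ S.see γ = S.B • fderiv ℝ (S.seeTilde γ) γ := by
  have d1 := S.differentiableAt_see hp hB hE hRIS hγ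
  have d2 := S.differentiableAt_seeTilde hp hRIS γ hγ
  have hmin : IsLocalMin (fun z => S.see z - S.B * S.seeTilde γ z) γ := by
    filter_upwards [S.differentiable_totalPower.continuous.continuousAt.eventually_const_lt hγ]
      with z hz
    have := S.seeTilde_le hp hB hE hRIS hBw γ hz
    rw [S.seeTilde_self hp hB hE hRIS γ]
    linarith
  have h := hmin.fderiv_eq_zero
  rw [fderiv_fun_sub d1 (d2.const_mul _), fderiv_const_mul d2] at h
  exact sub_eq_zero.1 h

theorem fderiv_outPower (hp : ∀ k, 0 ≤ S.p k) (hRIS : 0 < S.varRIS)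
    (γ d : EuclideanSpace ℂ (Fin N)) : fderiv ℝ S.outPower γ d = 2 * blin S.R γ d := by
  rw [funext S.outPower_eq_quad, fderiv_quad (S.posSemidef_R hp hRIS).1]

/-- If no strictly feasible point of the surrogate problem at `γ` improves on `γ`, then `γ` is a
KKT point of the original problem. -/
theorem mem_kktSet_of_forall_le (hp : ∀ k, 0 ≤ S.p k) (hμ : ∀ k, 0 ≤ S.μ k)
    (hB : 0 < S.varB) (hE : 0 < S.varE) (hRIS : 0 < S.varRIS)
    (hBw : 0 < S.B) (hPR : 0 < S.PRmax) (hPc : 0 < S.Pc)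
    {γ : EuclideanSpace ℂ (Fin N)} (hγ : γ ∈ S.feasible)
    (h : ∀ z ∈ S.strictFeasibleTilde γ, S.seeTilde γ z ≤ S.seeTilde γ γ) : γ ∈ S.kktSet := by
  have hpos := S.totalPower_pos hp hμ hPc hγ
  have hR := S.posSemidef_R hp hRIS
  obtain ⟨hlo, hup⟩ := S.mem_feasible.1 hγ
  set D := fderiv ℝ (S.seeTilde γ) γ with hDdef
  set q := fderiv ℝ S.outPower γ with hqdef
  have hq : ∀ d, q d = 2 * blin S.R γ d := S.fderiv_outPower hp hRIS γ
  have hqγ : q γ = 2 * S.outPower γ := by rw [hq, blin_self, outPower_eq_quad]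
  -- A direction that strictly relaxes every active constraint enters the strictly feasible set at
  -- once. The point `γ` may itself lie outside that set; a tangent direction is enough.
  have hD : ∀ d, (S.trR < S.outPower γ ∨ 0 < q d) →
      (S.outPower γ < S.PRmax + S.trR ∨ q d < 0) → D d ≤ 0 := by
    intro d h1 h2
    have hmax : IsLocalMaxOn (S.seeTilde γ) (S.strictFeasibleTilde γ) γ :=
      eventually_nhdsWithin_of_forall h
    refine hmax.hasFDerivWithinAt_nonpos
      (S.differentiableAt_seeTilde hp hRIS γ hpos).hasFDerivAt.hasFDerivWithinAt
      (mem_posTangentConeAt_of_frequently_mem (Eventually.frequently ?_))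
    have e1 : ∀ᶠ t : ℝ in 𝓝[>] 0, S.outPower γ + t * (q d + t * quad S.R d) <
        S.PRmax + S.trR := by
      rcases h2 with h2 | h2
      · have : ContinuousAt (fun t : ℝ => S.outPower γ + t * (q d + t * quad S.R d)) 0 := by
          fun_prop
        exact (this.eventually_lt_const (by simpa using h2)).filter_mono nhdsWithin_le_nhds
      · have : ContinuousAt (fun t : ℝ => q d + t * quad S.R d) 0 := by fun_prop
        filter_upwards [(this.eventually_lt_const (u := 0) (by simpa using h2)).filter_mono
          nhdsWithin_le_nhds, self_mem_nhdsWithin] with t ht ht0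
        have := mul_neg_of_pos_of_neg ht0 ht
        linarith
    have e2 : ∀ᶠ t : ℝ in 𝓝[>] 0, S.trR < S.outPower γ + t * q d := by
      rcases h1 with h1 | h1
      · have : ContinuousAt (fun t : ℝ => S.outPower γ + t * q d) 0 := by fun_prop
        exact (this.eventually_const_lt (by simpa using h1)).filter_mono nhdsWithin_le_nhds
      · filter_upwards [self_mem_nhdsWithin] with t ht0
        have := mul_pos (show (0 : ℝ) < t from ht0) h1
        linarith
    filter_upwards [e1, e2] with t h1 h2
    rw [hq, outPower_eq_quad] at h1 h2
    refine ⟨?_, ?_⟩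
    · rw [outPower_eq_quad, quad_add_smul hR.1]
      linarith
    · rw [linearised_eq, blin_add_right, blin_smul_right, blin_self]
      linarith
  obtain ⟨l₀, l₁, hl₀, hl₁, hs₀, hs₁, hDq⟩ : ∃ l₀ l₁ : ℝ, 0 ≤ l₀ ∧ 0 ≤ l₁ ∧
      l₀ * (S.trR - S.outPower γ) = 0 ∧ l₁ * (S.outPower γ - (S.PRmax + S.trR)) = 0 ∧
      D = l₀ • (-q) + l₁ • q := by
    -- For `N = 0` the trace is zero and `q γ > 0` fails, but the space is trivial. Otherwise `q γ ≥
    -- 2 * trR > 0`.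
    by_cases hN : N = 0
    · subst hN
      refine ⟨0, 0, le_rfl, le_rfl, by simp, by simp, ?_⟩
      ext d
      rw [Subsingleton.elim d 0]
      simp
    have htr : 0 < S.trR := by
      rw [trR_eq]
      have : Nonempty (Fin N) := ⟨⟨0, Nat.pos_of_ne_zero hN⟩⟩
      exact Finset.sum_pos (fun n _ => hRIS.trans_le (S.varRIS_le_rdiag hp n))
        Finset.univ_nonempty
    have hu : 0 < q γ := by rw [hqγ]; linarith
    -- Since `PRmax > 0`, the two bounds are never active together, so one half-space argument gives
    -- the multiplier.
    rcases hlo.eq_or_lt with hlo' | hlo'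
    · obtain ⟨l, hl, e⟩ := eq_neg_smul_of_nonpos (D := D) hu
        fun d hd => hD d (Or.inr hd) (Or.inl (by linarith))
      exact ⟨l, 0, hl, le_rfl, by rw [hlo']; ring, by ring, by simp [e]⟩
    · rcases hup.eq_or_lt with hup' | hup'
      · obtain ⟨l, hl, e⟩ := eq_neg_smul_of_nonpos (D := D) (q := -q) (u := -γ) (by simpa using hu)
          fun d hd => hD d (Or.inl hlo') (Or.inr (by simpa using hd))
        exact ⟨0, l, le_rfl, hl, by ring, by rw [hup']; ring, by simp [e]⟩
      · refine ⟨0, 0, le_rfl, le_rfl, by ring, by ring, ?_⟩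
        ext d
        have h1 := hD d (Or.inl hlo') (Or.inl hup')
        have h2 := hD (-d) (Or.inl hlo') (Or.inl hup')
        rw [map_neg] at h2
        simpa using le_antisymm h1 (by linarith)
  have hdo := S.differentiable_outPower γ
  have f0 : fderiv ℝ (S.constr 0) γ = -q := by
    show fderiv ℝ (fun γ => S.trR - S.outPower γ) γ = -q
    rw [fderiv_const_sub]
  have f1 : fderiv ℝ (S.constr 1) γ = q := by
    show fderiv ℝ (fun γ => S.outPower γ - (S.PRmax + S.trR)) γ = q
    rw [fderiv_sub_const]
  refine ⟨S.differentiableAt_see hp hB hE hRIS hpos, ?_, hγ, ![S.B * l₀, S.B * l₁], ?_, ?_, ?_⟩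
  · rw [Fin.forall_fin_two]
    exact ⟨hdo.const_sub S.trR, hdo.sub_const (S.PRmax + S.trR)⟩
  · rw [Fin.forall_fin_two]
    exact ⟨mul_nonneg hBw.le hl₀, mul_nonneg hBw.le hl₁⟩
  · rw [Fin.forall_fin_two]
    refine ⟨?_, ?_⟩
    · show S.B * l₀ * (S.trR - S.outPower γ) = 0
      rw [mul_assoc, hs₀, mul_zero]
    · show S.B * l₁ * (S.outPower γ - (S.PRmax + S.trR)) = 0
      rw [mul_assoc, hs₁, mul_zero]
  · rw [S.fderiv_see hp hB hE hRIS hBw hpos, Fin.sum_univ_two, f0, f1, ← hDdef, hDq]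
    simp only [Matrix.cons_val_zero, Matrix.cons_val_one, smul_add, smul_smul]

/-! ### Convergence of the algorithm -/

/-- The solution value of a surrogate problem controls the distance of its solution to the base
point, by strong convexity of the consumed power. -/
theorem sq_dist_le (hp : ∀ k, 0 ≤ S.p k) (hμ : ∀ k, 0 ≤ S.μ k)
    (hB : 0 < S.varB) (hE : 0 < S.varE) (hRIS : 0 < S.varRIS) (hPc : 0 < S.Pc)
    {a b : EuclideanSpace ℂ (Fin N)} (ha : a ∈ S.feasible) (hb : S.IsSubproblemSolution a b)
    (hv : 0 ≤ S.seeTilde a b) :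
    S.seeTilde a b * (S.varRIS * ‖b - a‖ ^ 2) ≤
      2 * (S.totalPower a * (S.seeTilde a b - S.seeTilde a a)) := by
  have hpa := S.totalPower_pos hp hμ hPc ha
  have hpb := S.totalPower_pos hp hμ hPc (S.feasibleTilde_subset hp hRIS a hb.1)
  -- At the midpoint the numerator is at least the average, while the denominator falls below its
  -- average by `quad S.R (b - a) / 4`; optimality of `b` limits this advantage.
  set m := (1 / 2 : ℝ) • b + (1 / 2 : ℝ) • a with hm
  have hmem : m ∈ S.feasibleTilde a := S.convex_feasibleTilde hp hRIS a hb.1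
    (S.self_mem_feasibleTilde ha) (by norm_num) (by norm_num) (by norm_num)
  have hpm := S.totalPower_pos hp hμ hPc (S.feasibleTilde_subset hp hRIS a hmem)
  have h1 : S.seeTilde a m ≤ S.seeTilde a b := hb.2 hmem
  have h2 : S.ssrTilde a m ≤ S.seeTilde a b * S.totalPower m := by
    rw [seeTilde, div_le_iff₀ hpm] at h1
    exact h1
  have h3 : (1 / 2 : ℝ) * S.ssrTilde a b + (1 / 2 : ℝ) * S.ssrTilde a a ≤ S.ssrTilde a m :=
    (S.concaveOn_ssrTilde hp hB hE hRIS a).2 trivial trivial (by norm_num) (by norm_num)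
      (by norm_num)
  have h4 : S.ssrTilde a b = S.seeTilde a b * S.totalPower b := by
    rw [seeTilde, div_mul_cancel₀ _ hpb.ne']
  have h5 : S.ssrTilde a a = S.seeTilde a a * S.totalPower a := by
    rw [seeTilde, div_mul_cancel₀ _ hpa.ne']
  have h6 : S.totalPower m = 1 / 2 * S.totalPower b + 1 / 2 * S.totalPower a -
      1 / 4 * quad S.R (b - a) := by
    simp only [totalPower, outPower_eq_quad, hm]
    rw [quad_combo _ (by norm_num)]
    ring
  have h7 := mul_le_mul_of_nonneg_left (S.le_quad_R hp (b - a)) hv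
  have h8 : S.seeTilde a b * S.totalPower m = 1 / 2 * (S.seeTilde a b * S.totalPower b) +
      1 / 2 * (S.seeTilde a b * S.totalPower a) -
      1 / 4 * (S.seeTilde a b * quad S.R (b - a)) := by
    rw [h6]; ring
  rw [h4, h5] at h3
  linarith

/-- A sequence in a compact set approaches every set containing all of its cluster points. -/
theorem tendsto_infDist_of_mapClusterPt {X : Type*} [PseudoMetricSpace X] {C A : Set X}
    (hC : IsCompact C) {u : ℕ → X} (hu : ∀ n, u n ∈ C)
    (hA : ∀ x, MapClusterPt x atTop u → x ∈ A) :
    Tendsto (fun n => Metric.infDist (u n) A) atTop (𝓝 0) := by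
  rw [tendsto_order]
  refine ⟨fun r hr => Eventually.of_forall fun n => hr.trans_le Metric.infDist_nonneg,
    fun r hr => ?_⟩
  by_contra hcon
  have hfr : ∃ᶠ n in atTop, n ∈ {n | r ≤ Metric.infDist (u n) A} := by
    refine (not_eventually.1 hcon).mono fun n hn => ?_
    exact not_lt.1 hn
  have hne : (atTop ⊓ 𝓟 {n | r ≤ Metric.infDist (u n) A}).NeBot :=
    frequently_mem_iff_neBot.1 hfr
  -- Clustering along the bad indices only yields a point of `A` that the sequence approaches while
  -- staying at distance at least `r` from `A`.
  obtain ⟨x, -, hx⟩ := hC.exists_mapClusterPt (u := u)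
    (f := atTop ⊓ 𝓟 {n | r ≤ Metric.infDist (u n) A})
    (tendsto_principal.2 (Eventually.of_forall hu))
  have hxA : x ∈ A := hA x (hx.mono (map_mono inf_le_left))
  have hnear : ∀ᶠ y in 𝓝 x, Metric.infDist y A < r :=
    (Metric.continuous_infDist_pt A).continuousAt.eventually_lt_const
      (by simpa [Metric.infDist_zero_of_mem hxA] using hr)
  have hev : ∀ᶠ n in atTop ⊓ 𝓟 {n | r ≤ Metric.infDist (u n) A},
      r ≤ Metric.infDist (u n) A := mem_inf_of_right (mem_principal_self _)
  obtain ⟨n, h1, h2⟩ := ((hx.frequently hnear).and_eventually hev).exists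
  exact absurd h1 (not_lt.2 h2)

namespace IsAlgorithmRun

variable {S} {γ : ℕ → EuclideanSpace ℂ (Fin N)}

theorem mem_feasible (hγ : S.IsAlgorithmRun γ) (hp : ∀ k, 0 ≤ S.p k) (hRIS : 0 < S.varRIS)
    (n : ℕ) : γ n ∈ S.feasible := by
  cases n with
  | zero => exact hγ.1
  | succ n => exact S.feasibleTilde_subset hp hRIS _ (hγ.2 n).1

theorem seeTilde_le_succ (hγ : S.IsAlgorithmRun γ) {n : ℕ} {z : EuclideanSpace ℂ (Fin N)}
    (hz : z ∈ S.feasibleTilde (γ n)) : S.seeTilde (γ n) z ≤ S.seeTilde (γ n) (γ (n + 1)) :=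
  (hγ.2 n).2 hz

theorem seeTilde_le_see_succ (hγ : S.IsAlgorithmRun γ) (hp : ∀ k, 0 ≤ S.p k)
    (hμ : ∀ k, 0 ≤ S.μ k) (hB : 0 < S.varB) (hE : 0 < S.varE) (hRIS : 0 < S.varRIS)
    (hBw : 0 < S.B) (hPc : 0 < S.Pc) (n : ℕ) :
    S.B * S.seeTilde (γ n) (γ (n + 1)) ≤ S.see (γ (n + 1)) :=
  S.seeTilde_le hp hB hE hRIS hBw _ (S.totalPower_pos hp hμ hPc (hγ.mem_feasible hp hRIS _))

theorem see_le_seeTilde (hγ : S.IsAlgorithmRun γ) (hp : ∀ k, 0 ≤ S.p k)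
    (hB : 0 < S.varB) (hE : 0 < S.varE) (hRIS : 0 < S.varRIS) (hBw : 0 < S.B) (n : ℕ) :
    S.see (γ n) ≤ S.B * S.seeTilde (γ n) (γ (n + 1)) := by
  rw [← S.seeTilde_self hp hB hE hRIS]
  exact mul_le_mul_of_nonneg_left
    (hγ.seeTilde_le_succ (S.self_mem_feasibleTilde (hγ.mem_feasible hp hRIS n))) hBw.le

theorem see_monotone (hγ : S.IsAlgorithmRun γ) (hp : ∀ k, 0 ≤ S.p k)
    (hμ : ∀ k, 0 ≤ S.μ k) (hB : 0 < S.varB) (hE : 0 < S.varE) (hRIS : 0 < S.varRIS)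
    (hBw : 0 < S.B) (hPc : 0 < S.Pc) : Monotone fun n => S.see (γ n) :=
  monotone_nat_of_le_succ fun n => (hγ.see_le_seeTilde hp hB hE hRIS hBw n).trans
    (hγ.seeTilde_le_see_succ hp hμ hB hE hRIS hBw hPc n)

/-- Without a gain in the surrogate, `γ n` solves its own subproblem and is therefore a KKT point.
-/
theorem see_lt_succ (hγ : S.IsAlgorithmRun γ) (hp : ∀ k, 0 ≤ S.p k)
    (hμ : ∀ k, 0 ≤ S.μ k) (hB : 0 < S.varB) (hE : 0 < S.varE) (hRIS : 0 < S.varRIS)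
    (hBw : 0 < S.B) (hPR : 0 < S.PRmax) (hPc : 0 < S.Pc) {n : ℕ} (hn : γ n ∉ S.kktSet) :
    S.see (γ n) < S.see (γ (n + 1)) := by
  refine lt_of_lt_of_le ?_ (hγ.seeTilde_le_see_succ hp hμ hB hE hRIS hBw hPc n)
  rw [← S.seeTilde_self hp hB hE hRIS]
  refine mul_lt_mul_of_pos_left ?_ hBw
  by_contra hle
  refine hn (S.mem_kktSet_of_forall_le hp hμ hB hE hRIS hBw hPR hPc
    (hγ.mem_feasible hp hRIS n) fun z hz => ?_)
  exact (hγ.seeTilde_le_succ (S.strictFeasibleTilde_subset _ hz)).trans (not_lt.1 hle)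

theorem exists_tendsto_see (hγ : S.IsAlgorithmRun γ) (hp : ∀ k, 0 ≤ S.p k)
    (hμ : ∀ k, 0 ≤ S.μ k) (hB : 0 < S.varB) (hE : 0 < S.varE) (hRIS : 0 < S.varRIS)
    (hBw : 0 < S.B) (hPc : 0 < S.Pc) :
    ∃ L, Tendsto (fun n => S.see (γ n)) atTop (𝓝 L) ∧ ∀ n, S.see (γ n) ≤ L := by
  have hbdd : BddAbove (S.see '' S.feasible) :=
    (S.isCompact_feasible hp hRIS).bddAbove_image fun z hz =>
      (S.differentiableAt_see hp hB hE hRIS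
        (S.totalPower_pos hp hμ hPc hz)).continuousAt.continuousWithinAt
  have hbdd' : BddAbove (Set.range fun n => S.see (γ n)) :=
    by
    refine hbdd.mono (Set.range_subset_iff.2 fun n => ?_)
    exact Set.mem_image_of_mem _ (hγ.mem_feasible hp hRIS n)
  exact ⟨_, tendsto_atTop_ciSup (hγ.see_monotone hp hμ hB hE hRIS hBw hPc) hbdd',
    fun n => le_ciSup hbdd' n⟩

theorem see_eq_of_mapClusterPt (hγ : S.IsAlgorithmRun γ) (hp : ∀ k, 0 ≤ S.p k)
    (hμ : ∀ k, 0 ≤ S.μ k) (hB : 0 < S.varB) (hE : 0 < S.varE) (hRIS : 0 < S.varRIS)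
    (hPc : 0 < S.Pc) {x : EuclideanSpace ℂ (Fin N)} (hx : MapClusterPt x atTop γ) {L : ℝ}
    (hL : Tendsto (fun n => S.see (γ n)) atTop (𝓝 L)) : x ∈ S.feasible ∧ S.see x = L := by
  have hxf : x ∈ S.feasible := (S.isCompact_feasible hp hRIS).isClosed.mem_of_mapClusterPt hx
    (Eventually.of_forall fun n => hγ.mem_feasible hp hRIS n)
  have hc := (S.differentiableAt_see hp hB hE hRIS (S.totalPower_pos hp hμ hPc hxf)).continuousAt
  refine ⟨hxf, ?_⟩
  have h1 : MapClusterPt (S.see x) atTop (S.see ∘ γ) := hx.continuousAt_comp hc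
  exact eq_of_nhds_neBot (h1.clusterPt.neBot.mono (inf_le_inf_left _ hL))

theorem mem_kktSet_of_mapClusterPt (hγ : S.IsAlgorithmRun γ) (hp : ∀ k, 0 ≤ S.p k)
    (hμ : ∀ k, 0 ≤ S.μ k) (hB : 0 < S.varB) (hE : 0 < S.varE) (hRIS : 0 < S.varRIS)
    (hBw : 0 < S.B) (hPR : 0 < S.PRmax) (hPc : 0 < S.Pc)
    {x : EuclideanSpace ℂ (Fin N)} (hx : MapClusterPt x atTop γ) : x ∈ S.kktSet := by
  obtain ⟨L, hL, hle⟩ := hγ.exists_tendsto_see hp hμ hB hE hRIS hBw hPc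
  obtain ⟨hxf, hsee⟩ := hγ.see_eq_of_mapClusterPt hp hμ hB hE hRIS hPc hx hL
  refine S.mem_kktSet_of_forall_le hp hμ hB hE hRIS hBw hPR hPc hxf fun z hz => ?_
  by_contra hlt
  push Not at hlt
  have hc : Continuous fun y => S.seeTilde y z :=
    (S.continuous_ssrTilde_left hp hB hE hRIS z).div_const _
  have hl : Continuous fun y => quad S.R y + 2 * lin S.R y z := by
    simp only [linearised_eq]
    exact (continuous_const.mul (continuous_blin_left S.R z)).sub (continuous_quad S.R)
  -- Some iterate near `x` still admits `z` with a surrogate value above that at `x`; its successor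
  -- would then exceed the limit `L`.
  obtain ⟨n, h1, h2⟩ := (hx.frequently ((hc.continuousAt.eventually_const_lt hlt).and
    (hl.continuousAt.eventually_const_lt hz.2))).exists
  have h3 := hγ.seeTilde_le_succ (n := n) (z := z) ⟨hz.1.le, h2.le⟩
  have h4 := mul_lt_mul_of_pos_left (h1.trans_le h3) hBw
  rw [S.seeTilde_self hp hB hE hRIS, hsee] at h4
  have h5 := hγ.seeTilde_le_see_succ hp hμ hB hE hRIS hBw hPc n
  linarith [hle (n + 1)]

theorem tendsto_see_succ_sub (hγ : S.IsAlgorithmRun γ) (hp : ∀ k, 0 ≤ S.p k)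
    (hμ : ∀ k, 0 ≤ S.μ k) (hB : 0 < S.varB) (hE : 0 < S.varE) (hRIS : 0 < S.varRIS)
    (hBw : 0 < S.B) (hPc : 0 < S.Pc) :
    Tendsto (fun n => S.see (γ (n + 1)) - S.see (γ n)) atTop (𝓝 0) := by
  obtain ⟨L, hL, -⟩ := hγ.exists_tendsto_see hp hμ hB hE hRIS hBw hPc
  simpa using (hL.comp (tendsto_add_atTop_nat 1)).sub hL

/-- Once the objective is positive, monotonicity keeps the coefficient in `sq_dist_le` away from
zero, so squared steps are dominated by the vanishing increments of `see`. -/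
theorem tendsto_norm_succ_sub (hγ : S.IsAlgorithmRun γ) (hp : ∀ k, 0 ≤ S.p k)
    (hμ : ∀ k, 0 ≤ S.μ k) (hB : 0 < S.varB) (hE : 0 < S.varE) (hRIS : 0 < S.varRIS)
    (hBw : 0 < S.B) (hPc : 0 < S.Pc) {n₀ : ℕ} (hn₀ : 0 < S.ssr (γ n₀)) :
    Tendsto (fun n => ‖γ (n + 1) - γ n‖) atTop (𝓝 0) := by
  have hfeas := hγ.mem_feasible hp hRIS
  have hpos := fun n => S.totalPower_pos hp hμ hPc (hfeas n)
  set T := S.PRmax + S.trR + S.Pceq with hT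
  have hv₀ : 0 < S.see (γ n₀) := mul_pos hBw (div_pos hn₀ (hpos n₀))
  have hbound : ∀ᶠ n in atTop, ‖γ (n + 1) - γ n‖ ^ 2 ≤
      2 * T / (S.see (γ n₀) * S.varRIS) * (S.see (γ (n + 1)) - S.see (γ n)) := by
    filter_upwards [eventually_ge_atTop n₀] with n hn
    have h1 := hγ.see_monotone hp hμ hB hE hRIS hBw hPc hn
    have h2 := hγ.see_le_seeTilde hp hB hE hRIS hBw n
    have h3 := hγ.seeTilde_le_see_succ hp hμ hB hE hRIS hBw hPc n
    have h4 := hγ.see_monotone hp hμ hB hE hRIS hBw hPc (Nat.le_succ n)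
    simp only [Nat.succ_eq_add_one] at h1 h4
    have hv : 0 ≤ S.seeTilde (γ n) (γ (n + 1)) := by
      by_contra hneg
      have := mul_neg_of_pos_of_neg hBw (not_le.1 hneg)
      linarith
    have h5 := mul_le_mul_of_nonneg_left
      (S.sq_dist_le hp hμ hB hE hRIS hPc (hfeas n) (hγ.2 n) hv) hBw.le
    have h6 : S.B * (2 * (S.totalPower (γ n) *
        (S.seeTilde (γ n) (γ (n + 1)) - S.seeTilde (γ n) (γ n)))) =
        2 * (S.totalPower (γ n) * (S.B * S.seeTilde (γ n) (γ (n + 1)) - S.see (γ n))) := by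
      rw [← S.seeTilde_self hp hB hE hRIS]; ring
    have h7 : S.totalPower (γ n) * (S.B * S.seeTilde (γ n) (γ (n + 1)) - S.see (γ n)) ≤
        T * (S.see (γ (n + 1)) - S.see (γ n)) :=
      mul_le_mul (S.totalPower_le (hfeas n)) (by linarith) (by linarith)
        ((hpos n).le.trans (S.totalPower_le (hfeas n)))
    have h8 : S.see (γ n₀) * (S.varRIS * ‖γ (n + 1) - γ n‖ ^ 2) ≤
        S.B * S.seeTilde (γ n) (γ (n + 1)) * (S.varRIS * ‖γ (n + 1) - γ n‖ ^ 2) :=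
      mul_le_mul_of_nonneg_right (h1.trans h2) (by positivity)
    rw [div_mul_eq_mul_div, le_div_iff₀ (by positivity)]
    linarith
  have hsq : Tendsto (fun n => ‖γ (n + 1) - γ n‖ ^ 2) atTop (𝓝 0) := by
    refine tendsto_of_tendsto_of_tendsto_of_le_of_le' tendsto_const_nhds ?_
      (Eventually.of_forall fun n => sq_nonneg _) hbound
    simpa using (hγ.tendsto_see_succ_sub hp hμ hB hE hRIS hBw hPc).const_mul
      (2 * T / (S.see (γ n₀) * S.varRIS))
  simpa using hsq.sqrt

end IsAlgorithmRun

end RISSystem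

end

/-! ### The main theorem -/

theorem proposition1 {K N NB : ℕ} (S : RISSystem K N NB)
    (hp : ∀ k, 0 ≤ S.p k) (hμ : ∀ k, 0 ≤ S.μ k)
    (hB : 0 < S.varB) (hE : 0 < S.varE) (hRIS : 0 < S.varRIS)
    (hBw : 0 < S.B) (hPR : 0 < S.PRmax) (hPc : 0 < S.Pc) :
    -- the problem is feasible
    S.feasible.Nonempty ∧
    -- at every feasible point, the surrogate problem is a fractional program with concave
    -- numerator, convex denominator (positive where needed) and convex feasible set, it bounds
    -- the original problem from below, tightly at that point, and it has a solution
    (∀ γb ∈ S.feasible,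
      ConcaveOn ℝ Set.univ (S.ssrTilde γb) ∧
      ConvexOn ℝ Set.univ S.totalPower ∧
      Convex ℝ (S.feasibleTilde γb) ∧
      (∀ γ ∈ S.feasibleTilde γb, 0 < S.totalPower γ) ∧
      (∀ γ, S.ssrTilde γb γ ≤ S.ssr γ) ∧ S.ssrTilde γb γb = S.ssr γb ∧
      γb ∈ S.feasibleTilde γb ∧ S.feasibleTilde γb ⊆ S.feasible ∧
      ∃ γs, S.IsSubproblemSolution γb γs) ∧
    -- every run of the algorithm
    ∀ γ : ℕ → EuclideanSpace ℂ (Fin N), S.IsAlgorithmRun γ →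
      -- stays feasible and monotonically improves the objective, strictly at non-KKT points
      (∀ n, γ n ∈ S.feasible) ∧
      (∀ n, S.see (γ n) ≤ S.see (γ (n + 1))) ∧
      (∀ n, γ n ∉ S.kktSet → S.see (γ n) < S.see (γ (n + 1))) ∧
      -- meets the stopping rule for every tolerance
      (∀ ε : ℝ, 0 < ε → ∃ n, |S.see (γ (n + 1)) - S.see (γ n)| < ε) ∧
      -- converges to KKT points: accumulation points exist, all of them are KKT points, the
      -- objective converges to their common value, the distance to the set of KKT points
      -- vanishes
      (∃ γlim, MapClusterPt γlim atTop γ) ∧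
      (∀ γlim, MapClusterPt γlim atTop γ →
        γlim ∈ S.kktSet ∧ Tendsto (fun n => S.see (γ n)) atTop (𝓝 (S.see γlim))) ∧
      Tendsto (fun n => Metric.infDist (γ n) S.kktSet) atTop (𝓝 0) ∧
      -- and consecutive iterates merge once the secrecy rate is positive
      ((∃ n, 0 < S.ssr (γ n)) → Tendsto (fun n => ‖γ (n + 1) - γ n‖) atTop (𝓝 0)) := by
  refine ⟨S.feasible_nonempty hPR, fun γb hγb => ⟨S.concaveOn_ssrTilde hp hB hE hRIS γb,
    S.convexOn_totalPower hp hRIS, S.convex_feasibleTilde hp hRIS γb,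
    fun γ hγ => S.totalPower_pos hp hμ hPc (S.feasibleTilde_subset hp hRIS γb hγ),
    S.ssrTilde_le_ssr hp hB hE hRIS γb, S.ssrTilde_self hp hB hE hRIS γb,
    S.self_mem_feasibleTilde hγb, S.feasibleTilde_subset hp hRIS γb,
    S.exists_isSubproblemSolution hp hμ hRIS hPc hγb⟩, fun γ hγ => ?_⟩
  have hfeas := hγ.mem_feasible hp hRIS
  have hcompact := S.isCompact_feasible hp hRIS
  have hkkt : ∀ x, MapClusterPt x atTop γ → x ∈ S.kktSet := fun x hx =>
    hγ.mem_kktSet_of_mapClusterPt hp hμ hB hE hRIS hBw hPR hPc hx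
  refine ⟨hfeas, fun n => hγ.see_monotone hp hμ hB hE hRIS hBw hPc n.le_succ,
    fun n hn => hγ.see_lt_succ hp hμ hB hE hRIS hBw hPR hPc hn, fun ε hε => ?_, ?_,
    fun x hx => ⟨hkkt x hx, ?_⟩,
    RISSystem.tendsto_infDist_of_mapClusterPt hcompact hfeas hkkt,
    fun ⟨n, hn⟩ => hγ.tendsto_norm_succ_sub hp hμ hB hE hRIS hBw hPc hn⟩
  · obtain ⟨n, hn⟩ := (Metric.tendsto_nhds.1
      (hγ.tendsto_see_succ_sub hp hμ hB hE hRIS hBw hPc) ε hε).exists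
    exact ⟨n, by simpa using hn⟩
  · obtain ⟨x, -, hx⟩ := hcompact.exists_mapClusterPt (f := atTop) (u := γ)
      (tendsto_principal.2 (Eventually.of_forall hfeas))
    exact ⟨x, hx⟩
  · obtain ⟨L, hL, -⟩ := hγ.exists_tendsto_see hp hμ hB hE hRIS hBw hPc
    rwa [(hγ.see_eq_of_mapClusterPt hp hμ hB hE hRIS hPc hx hL).2]
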